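/- Let $X=\begin{pmatrix}0&1\\1&0\end{pmatrix}$, $Y=\begin{pmatrix}0&-i\\i&0\end{pmatrix}$, $Z=\begin{pmatrix}1&0\\0&-1\end{pmatrix}$ be the Pauli matrices and let $P=\langle X,Y,Z\rangle$ be the (finite) group of unitary matrices that they generate. Let $U=P\rtimes\mathbb{Z}/3\mathbb{Z}$, where the generator $T$ of $\mathbb{Z}/3\mathbb{Z}$ permutes the Pauli matrices cyclically: $T^{-1}XT=Y$, $T^{-1}YT=Z$, $T^{-1}ZT=X$. Let $V=S_3$ and $W=\mathbb{Z}/6\mathbb{Z}$. Let $G$ be the direct limit of the triangle of groups with vertex groups $U,V,W$, edge groups $A=\mathbb{Z}/3\mathbb{Z}$, $B=C=\mathbb{Z}/2\mathbb{Z}$ and trivial face group, with maps $A,B\to U$ given by $T$ and $X$, maps $B,C\to V$ given by $(1,2)$ and $(2,3)$, and maps $A,C\to W$ given by $2$ and $3$; that is, $G$ is the quotient of $U*V*W$ by the relations $T=2_W$, $X=(1,2)$, $(2,3)=3_W$. Let $\Delta$ be its development: the 2-dimensional simplicial complex with vertex set $G/U\sqcup G/V\sqcup G/W$ whose triangles are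 the sets $gt_0=\{gU,gV,gW\}$, $g\in G$; the triangle $t_0=\{U,V,W\}$ is the fundamental triangle. Let $\tau\colon G\to\langle T\rangle\cong\mathbb{Z}/3\mathbb{Z}$ be the homomorphism that extends the projection $U=P\rtimes\langle T\rangle\to\langle T\rangle$ and is trivial on $V$, and mark each triangle of $\Delta$ with a Pauli matrix by $\pi(gt_0)=\tau(g)^{-1}X\,\tau(g)\in\{X,Y,Z\}$. Let $E$ be the Euclidean plane with its standard tiling by unit equilateral triangles (the faces of $E$). A Pauli puzzle is an assignment $p$ of a matrix in $\{X,Y,Z\}$ to every face of $E$ such that (1) faces with a common edge carry different matrices, and (2) at every vertex of the tiling, the cyclic product of the matrices on the six faces around it is the identity matrix. Let $H$ be the group of isometries of the plane that preserve the tiling; its fundamental triangles are the triangles of the barycentric subdivision of $E$. A Pauli puzzle is pointed at such a triangle $t$ if the face of $E$ that contains $t$ is marked $X$. **Theorem.** For every triangle $t$ of the barycentric subdivision of $E$ there is a bijection between the set of Pauli puzzles $p$ pointed at $t$ and the set of simplicial embeddings $f$ of the barycentric subdivision of $E$ into $\Delta$ with $f(t)=t_0$. In this bijection $p$ corresponds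 to $f$ if and only if $f$ preserves the Pauli matrices, that is, $\pi(f(s))=p(F)$ for every face $F$ of $E$ and every triangle $s$ of the barycentric subdivision contained in $F$. -/

import Mathlib

namespace PauliPuzzle

/-! ### Simplicial complexes -/

/-- The triangles (2-simplices) of a simplicial complex. -/
abbrev Triangle {α : Type} (K : AbstractSimplicialComplex α) : Type :=
  {s : Finset α // s ∈ K.faces ∧ s.card = 3}

/-- The barycentric subdivision: its vertices are the simplices of `K` (each one standing for
its barycentre), its simplices are the nonempty finite chains of simplices of `K`. -/
def sd {α : Type} (K : AbstractSimplicialComplex α) :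
    AbstractSimplicialComplex {s : Finset α // s ∈ K.faces} where
  faces := {c | c.Nonempty ∧ ∀ a ∈ c, ∀ b ∈ c, a.1 ⊆ b.1 ∨ b.1 ⊆ a.1}
  isRelLowerSet_faces := fun _ hc =>
    ⟨hc.1, fun _ hsub hne => ⟨hne, fun a ha b hb => hc.2 a (hsub ha) b (hsub hb)⟩⟩
  singleton_mem := fun v => ⟨Finset.singleton_nonempty v, by
    intro a ha b hb
    rw [Finset.mem_singleton] at ha hb
    subst ha
    subst hb
    exact Or.inl (Finset.Subset.refl _)⟩

/-- A simplicial embedding: an injective map on vertices that takes simplices to simplices. -/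
@[ext]
structure SimplicialEmbedding {α β : Type} (K : AbstractSimplicialComplex α)
    (L : AbstractSimplicialComplex β) where
  toEmbedding : α ↪ β
  map_mem : ∀ s ∈ K.faces, s.map toEmbedding ∈ L.faces

/-- The image of a triangle under a simplicial embedding. -/
def SimplicialEmbedding.mapTriangle {α β : Type} {K : AbstractSimplicialComplex α}
    {L : AbstractSimplicialComplex β} (f : SimplicialEmbedding K L) (t : Triangle K) :
    Triangle L :=
  ⟨t.1.map f.toEmbedding, f.map_mem t.1 t.2.1, by rw [Finset.card_map, t.2.2]⟩

/-! ### The Euclidean plane tiled by unit equilateral triangles -/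

/-- The vertex of the tiling with coordinates `(a, b)` is the point `a + b * exp (i π / 3)` of
the Euclidean plane `ℂ`. -/
noncomputable def pos (v : ℤ × ℤ) : ℂ :=
  (v.1 : ℂ) + (v.2 : ℂ) * ⟨1 / 2, Real.sqrt 3 / 2⟩

theorem dist_pos_le_one_iff (v w : ℤ × ℤ) :
    dist (pos v) (pos w) ≤ 1 ↔
      (v.1 - w.1) ^ 2 + (v.1 - w.1) * (v.2 - w.2) + (v.2 - w.2) ^ 2 ≤ 1 := by
  have h3 : Real.sqrt 3 * Real.sqrt 3 = 3 := Real.mul_self_sqrt (by norm_num)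
  have key : Complex.normSq (pos v - pos w) =
      (((v.1 - w.1) ^ 2 + (v.1 - w.1) * (v.2 - w.2) + (v.2 - w.2) ^ 2 : ℤ) : ℝ) := by
    rw [Complex.normSq_apply]
    simp only [pos, Complex.sub_re, Complex.sub_im, Complex.add_re, Complex.add_im,
      Complex.mul_re, Complex.mul_im, Complex.intCast_re, Complex.intCast_im]
    push_cast
    linear_combination (((v.2 : ℝ) - w.2) ^ 2 / 4) * h3
  rw [Complex.dist_eq, ← sq_le_one_iff₀ (norm_nonneg _), ← Complex.normSq_eq_norm_sq, key]
  exact_mod_cast Iff.rfl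

/-- The tiled plane `E`: its simplices are the nonempty finite sets of tiling vertices at mutual
Euclidean distance at most `1`, that is, the vertices, the edges and the unit equilateral
triangles of the tiling. -/
def E : AbstractSimplicialComplex (ℤ × ℤ) where
  faces := {s | s.Nonempty ∧ ∀ v ∈ s, ∀ w ∈ s, dist (pos v) (pos w) ≤ 1}
  isRelLowerSet_faces := fun _ hs =>
    ⟨hs.1, fun _ hsub hne => ⟨hne, fun v hv w hw => hs.2 v (hsub hv) w (hsub hw)⟩⟩
  singleton_mem := fun v => ⟨Finset.singleton_nonempty v, by
    intro a ha b hb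
    rw [Finset.mem_singleton] at ha hb
    subst ha
    subst hb
    simp⟩

/-- The six unit directions of the tiling in counterclockwise order: `pos (dir i)` is
`exp (i π / 3) ^ i`. -/
def dir : Fin 6 → ℤ × ℤ := ![(1, 0), (0, 1), (-1, 1), (-1, 0), (0, -1), (1, -1)]

/-- The six triangles of the tiling around the vertex `v`, in counterclockwise order. -/
def around (v : ℤ × ℤ) (i : Fin 6) : Triangle E :=
  ⟨{v, v + dir i, v + dir (i + 1)}, by
    refine ⟨⟨⟨v, by simp⟩, ?_⟩, ?_⟩
    · intro a ha b hb
      rw [dist_pos_le_one_iff]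
      simp only [Finset.mem_insert, Finset.mem_singleton] at ha hb
      rcases ha with rfl | rfl | rfl <;> rcases hb with rfl | rfl | rfl <;>
        fin_cases i <;> simp [dir]
    · obtain ⟨x, y⟩ := v
      rw [Finset.card_eq_three]
      refine ⟨_, _, _, ?_, ?_, ?_, rfl⟩ <;> fin_cases i <;> simp [dir]⟩

/-- A triangle `s` of the barycentric subdivision of `E` lies in the face `F` of `E` if and only
if the barycentre of `F` is a vertex of `s`. -/
def LiesIn (s : Triangle (sd E)) (F : Triangle E) : Prop :=
  (⟨F.1, F.2.1⟩ : {s : Finset (ℤ × ℤ) // s ∈ E.faces}) ∈ s.1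

/-- Every triangle of the barycentric subdivision of `E` lies in exactly one face of `E`. -/
theorem existsUnique_liesIn (s : Triangle (sd E)) : ∃! F : Triangle E, LiesIn s F := by
  have hcard : ∀ a : {s : Finset (ℤ × ℤ) // s ∈ E.faces}, a.1.card ∈ Finset.Icc 1 3 := by
    intro a
    rw [Finset.mem_Icc]
    refine ⟨Finset.card_pos.mpr a.2.1, ?_⟩
    have hinj : Set.InjOn (fun v : ℤ × ℤ => ((v.1 - v.2 : ℤ) : ZMod 3)) (a.1 : Set (ℤ × ℤ)) := by
      intro v hv w hw hvw
      have hd := (dist_pos_le_one_iff v w).1 (a.2.2 v hv w hw)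
      have h3 : ((3 : ℕ) : ℤ) ∣ (w.1 - w.2) - (v.1 - v.2) :=
        (ZMod.intCast_eq_intCast_iff_dvd_sub _ _ 3).1 hvw
      obtain ⟨k, hk⟩ := h3
      push_cast at hk
      have hx : v.1 - w.1 = (v.2 - w.2) - 3 * k := by linarith
      rw [hx] at hd
      generalize v.2 - w.2 = y at hd hx
      have h1 : 3 * (y ^ 2 - 3 * k * y + 3 * k ^ 2) ≤ 1 := by linarith
      have h2 : y ^ 2 - 3 * k * y + 3 * k ^ 2 ≤ 0 := by omega
      have hk0 : k = 0 := by nlinarith [sq_nonneg (2 * y - 3 * k), sq_nonneg k]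
      subst hk0
      have hy : y = 0 := by nlinarith [sq_nonneg y]
      apply Prod.ext <;> [skip; skip] <;> omega
    have := Finset.card_le_card_of_injOn (t := Finset.univ) _ (fun _ _ => Finset.mem_univ _) hinj
    simpa using this
  have hchain : ∀ a ∈ s.1, ∀ b ∈ s.1, a.1.card = b.1.card → a = b := by
    intro a ha b hb hab
    apply Subtype.ext
    rcases s.2.1.2 a ha b hb with h | h
    · exact Finset.eq_of_subset_of_card_le h hab.ge
    · exact (Finset.eq_of_subset_of_card_le h hab.le).symm
  have himg : s.1.image (fun a => a.1.card) = Finset.Icc 1 3 := by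
    apply Finset.eq_of_subset_of_card_le
    · intro n hn
      obtain ⟨a, -, rfl⟩ := Finset.mem_image.1 hn
      exact hcard a
    · rw [Finset.card_image_of_injOn (fun a ha b hb h => hchain a ha b hb h), s.2.2]
      simp
  have h3 : 3 ∈ s.1.image (fun a => a.1.card) := by rw [himg]; simp
  obtain ⟨a, ha, ha3⟩ := Finset.mem_image.1 h3
  refine ⟨⟨a.1, a.2, ha3⟩, ha, ?_⟩
  intro F hF
  have := hchain _ hF a ha (F.2.2.trans ha3.symm)
  apply Subtype.ext
  exact congrArg (fun a => a.1) this

/-! ### The Pauli matrices and the Pauli group -/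

/-- The names of the three Pauli matrices. -/
inductive Pauli : Type
  | X | Y | Z
  deriving DecidableEq

/-- The cyclic permutation `X ↦ Y ↦ Z ↦ X`. -/
def Pauli.next : Pauli → Pauli
  | .X => .Y
  | .Y => .Z
  | .Z => .X

/-- The Pauli matrices. -/
def Pauli.mat : Pauli → Matrix (Fin 2) (Fin 2) ℂ
  | .X => !![0, 1; 1, 0]
  | .Y => !![0, -Complex.I; Complex.I, 0]
  | .Z => !![1, 0; 0, -1]

/-- The Pauli matrices as unitary matrices. -/
def Pauli.unitary (M : Pauli) : Matrix.unitaryGroup (Fin 2) ℂ :=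
  ⟨M.mat, by
    rw [Matrix.mem_unitaryGroup_iff]
    cases M <;> ext i j <;> fin_cases i <;> fin_cases j <;>
      simp [Pauli.mat, Matrix.mul_apply, Fin.sum_univ_two, Matrix.star_apply]⟩

/-- The Pauli group, generated by the Pauli matrices. -/
def P : Subgroup (Matrix.unitaryGroup (Fin 2) ℂ) :=
  Subgroup.closure (Set.range Pauli.unitary)

/-- A Pauli matrix as an element of the Pauli group. -/
def Pauli.toP (M : Pauli) : P := ⟨M.unitary, Subgroup.subset_closure ⟨M, rfl⟩⟩

/-- The unitary matrix `(1 - i (X + Y + Z)) / 2`; conjugation by it permutes the Pauli matrices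
cyclically. -/
noncomputable def rot : Matrix.unitaryGroup (Fin 2) ℂ :=
  ⟨!![(1 - Complex.I) / 2, (-1 - Complex.I) / 2; (1 - Complex.I) / 2, (1 + Complex.I) / 2], by
    rw [Matrix.mem_unitaryGroup_iff]
    ext i j
    fin_cases i <;> fin_cases j <;>
      simp [Matrix.mul_apply, Fin.sum_univ_two, Matrix.star_apply, Complex.conj_ofNat] <;>
      ring_nf <;> simp [Complex.I_sq] <;> norm_num⟩

theorem rot_mul (M : Pauli) : rot * M.unitary = M.next.unitary * rot := by
  apply Subtype.ext
  cases M <;> ext i j <;> fin_cases i <;> fin_cases j <;>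
    simp [rot, Pauli.unitary, Pauli.next, Pauli.mat] <;>
    ring_nf <;> simp [Complex.I_sq] <;> ring

theorem rot_pow_three : (rot ^ 3).1 = -1 := by
  have h : (rot ^ 3).1 = rot.1 * rot.1 * rot.1 := by
    rw [pow_succ, pow_two]
    rfl
  have h2 := Complex.I_sq
  have h3 : Complex.I ^ 3 = -Complex.I := by rw [pow_succ, h2]; ring
  rw [h]
  ext i j
  fin_cases i <;> fin_cases j <;>
    simp [rot, Matrix.mul_apply, Fin.sum_univ_two] <;>
    ring_nf <;> simp [h2, h3] <;> ring_nf

theorem rot_mem_normalizer : rot ∈ Subgroup.normalizer (P : Set (Matrix.unitaryGroup (Fin 2) ℂ)) := by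
  have hmap : P.map (MulAut.conj rot).toMonoidHom = P := by
    rw [P, MonoidHom.map_closure]
    congr 1
    ext g
    constructor
    · rintro ⟨_, ⟨M, rfl⟩, rfl⟩
      refine ⟨M.next, ?_⟩
      simp [rot_mul]
    · rintro ⟨M, rfl⟩
      obtain ⟨N, rfl⟩ : ∃ N : Pauli, N.next = M := by
        cases M
        exacts [⟨.Z, rfl⟩, ⟨.X, rfl⟩, ⟨.Y, rfl⟩]
      exact ⟨N.unitary, ⟨N, rfl⟩, by simp [rot_mul]⟩
  rw [Subgroup.mem_normalizer_iff]
  intro h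
  constructor
  · intro hh
    have := Subgroup.mem_map_of_mem (MulAut.conj rot).toMonoidHom hh
    rw [hmap] at this
    simpa using this
  · intro hh
    rw [← hmap] at hh
    obtain ⟨k, hk, hkh⟩ := hh
    have : k = h := by simpa using hkh
    exact this ▸ hk

/-- The automorphism of the Pauli group that permutes the Pauli matrices cyclically. -/
noncomputable def cycle : MulAut P := P.normalizerMonoidHom ⟨rot, rot_mem_normalizer⟩

theorem cycle_toP (M : Pauli) : cycle M.toP = M.next.toP := by
  apply Subtype.ext
  change rot * M.unitary * rot⁻¹ = M.next.unitary
  rw [rot_mul, mul_inv_cancel_right]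

theorem cycle_pow_three : cycle ^ 3 = 1 := by
  have hr : ∀ A : Matrix.unitaryGroup (Fin 2) ℂ, rot ^ 3 * A = A * rot ^ 3 := by
    intro A
    apply Subtype.ext
    change (rot ^ 3).1 * A.1 = A.1 * (rot ^ 3).1
    rw [rot_pow_three]
    simp
  ext1 A
  apply Subtype.ext
  rw [cycle, ← map_pow]
  change rot ^ 3 * A.1 * (rot ^ 3)⁻¹ = A.1
  rw [hr, mul_inv_cancel_right]

/-- The action of `ℤ/3` on the Pauli group for which the generator `T` of `ℤ/3` satisfies
`T⁻¹ X T = Y`, `T⁻¹ Y T = Z` and `T⁻¹ Z T = X` in the semidirect product. -/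
noncomputable def act : Multiplicative (ZMod 3) →* MulAut P :=
  MonoidHom.mk' (fun k => (cycle ^ (Multiplicative.toAdd k).val)⁻¹) (by
    intro a b
    rw [← mul_inv_rev, ← pow_add, toAdd_mul, ZMod.val_add, add_comm,
      ← pow_eq_pow_mod _ cycle_pow_three])

/-! ### The triangle of groups and its direct limit -/

/-- The local group `U = P ⋊ ℤ/3`. -/
abbrev U : Type := P ⋊[act] Multiplicative (ZMod 3)

/-- The local group `V = S₃`. -/
abbrev V : Type := Equiv.Perm (Fin 3)

/-- The local group `W = ℤ/6`, written multiplicatively. -/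
abbrev W : Type := Multiplicative (ZMod 6)

/-- The generator of the factor `ℤ/3` of `U`. -/
noncomputable def T : U := SemidirectProduct.inr (Multiplicative.ofAdd 1)

/-- A Pauli matrix as an element of `U`. -/
noncomputable def Pauli.toU (M : Pauli) : U := SemidirectProduct.inl M.toP

theorem inv_T_mul_toU_mul_T (M : Pauli) : T⁻¹ * M.toU * T = M.next.toU := by
  have h : act (Multiplicative.ofAdd 1)⁻¹ = cycle := by
    rw [map_inv]
    change ((cycle ^ (1 : ZMod 3).val)⁻¹)⁻¹ = cycle
    rw [inv_inv, show (1 : ZMod 3).val = 1 from rfl, pow_one]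
  have h2 := SemidirectProduct.inl_aut (φ := act) (Multiplicative.ofAdd 1)⁻¹ M.toP
  rw [h, cycle_toP, inv_inv] at h2
  rw [T, ← map_inv]
  exact h2.symm

/-- The free product of `U`, `V` and `W`. -/
abbrev FreeProd : Type := Monoid.Coprod U (Monoid.Coprod V W)

/-- The inclusion of `U` in the free product. -/
noncomputable def freeU : U →* FreeProd := Monoid.Coprod.inl

/-- The inclusion of `V` in the free product. -/
noncomputable def freeV : V →* FreeProd := Monoid.Coprod.inr.comp Monoid.Coprod.inl

/-- The inclusion of `W` in the free product. -/
noncomputable def freeW : W →* FreeProd := Monoid.Coprod.inr.comp Monoid.Coprod.inr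

/-- The identifications in the triangle of groups, given on the generators of the cyclic groups
`A = ℤ/3` (mapped to `U` by `T` and to `W` by `2`), `B = ℤ/2` (mapped to `U` by `X` and to `V` by
the transposition `(1, 2)`) and `C = ℤ/2` (mapped to `V` by `(2, 3)` and to `W` by `3`). The set
`{1, 2, 3}` permuted by `V` is written `{0, 1, 2}`. -/
noncomputable def identifications : Set FreeProd :=
  {freeU T * (freeW (Multiplicative.ofAdd 2))⁻¹,
    freeU Pauli.X.toU * (freeV (Equiv.swap 0 1))⁻¹,
    freeV (Equiv.swap 1 2) * (freeW (Multiplicative.ofAdd 3))⁻¹}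

/-- The direct limit `G` of the triangle of groups. -/
abbrev G : Type := FreeProd ⧸ Subgroup.normalClosure identifications

/-- The canonical map of the free product onto `G`. -/
noncomputable def toG : FreeProd →* G := QuotientGroup.mk' _

/-- The homomorphism `tau` below, on the free product. -/
noncomputable def freeTau : FreeProd →* Multiplicative (ZMod 3) :=
  Monoid.Coprod.lift SemidirectProduct.rightHom
    (Monoid.Coprod.lift 1
      (AddMonoidHom.toMultiplicative
        ((AddMonoidHom.mulLeft (2 : ZMod 3)).comp
          (ZMod.castHom (by norm_num : 3 ∣ 6) (ZMod 3)).toAddMonoidHom)))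

/-- The homomorphism `τ` from `G` to the group of order three generated by `T`: it extends the
projection of `U = P ⋊ ℤ/3` onto `ℤ/3` and is trivial on `V`; on `W = ℤ/6` it takes `2` to the
generator and `3` to `0`, hence it is the residue modulo three of `n ↦ 2 n`. -/
noncomputable def tau : G →* Multiplicative (ZMod 3) :=
  QuotientGroup.lift _ freeTau (by
    intro x hx
    have hle : Subgroup.normalClosure identifications ≤ freeTau.ker := by
      apply Subgroup.normalClosure_le_normal
      rintro y (rfl | rfl | rfl)
      all_goals
        change freeTau _ = 1
        simp [freeTau, freeU, freeV, freeW, T, Pauli.toU]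
        try decide
    exact hle hx)

/-! ### The development -/

/-- The three vertices of the fundamental triangle. -/
inductive Corner : Type
  | u | v | w
  deriving DecidableEq

instance : Fintype Corner := ⟨{.u, .v, .w}, fun k => by cases k <;> simp⟩

/-- The stabilizers of the vertices of the fundamental triangle: the images of `U`, `V` and `W`
in `G`. -/
noncomputable def stab : Corner → Subgroup G
  | .u => (toG.comp freeU).range
  | .v => (toG.comp freeV).range
  | .w => (toG.comp freeW).range

/-- The vertices of the development: the disjoint union of the coset spaces `G ⧸ U`, `G ⧸ V` and
`G ⧸ W`. -/
abbrev Vertex : Type := Σ k : Corner, G ⧸ stab k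

/-- The triangle `g t₀` of the development, with vertices the cosets `g U`, `g V` and `g W`. -/
noncomputable def chamber (g : G) : Finset Vertex :=
  Finset.univ.map ⟨fun k => ⟨k, QuotientGroup.mk g⟩, fun _ _ h => congrArg Sigma.fst h⟩

/-- The development `Δ` of the triangle of groups: its simplices are the faces of the triangles
`g t₀` with `g ∈ G`. -/
noncomputable def Δ : AbstractSimplicialComplex Vertex where
  faces := {s | s.Nonempty ∧ ∃ g, s ⊆ chamber g}
  isRelLowerSet_faces := fun _ hs =>
    ⟨hs.1, fun _ hsub hne => ⟨hne, hs.2.imp fun _ h => hsub.trans h⟩⟩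
  singleton_mem := by
    rintro ⟨k, x⟩
    induction x using QuotientGroup.induction_on with
    | H g =>
      refine ⟨Finset.singleton_nonempty _, g, ?_⟩
      rw [Finset.singleton_subset_iff]
      exact Finset.mem_map.2 ⟨k, Finset.mem_univ k, rfl⟩

theorem card_chamber (g : G) : (chamber g).card = 3 := by
  rw [chamber, Finset.card_map]
  rfl

/-- The triangle `g t₀` of the development. -/
noncomputable def chamberΔ (g : G) : Triangle Δ :=
  ⟨chamber g, ⟨Finset.card_pos.1 (by rw [card_chamber]; norm_num), g, Finset.Subset.refl _⟩,
    card_chamber g⟩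

/-- The fundamental triangle of the development. -/
noncomputable def t₀ : Triangle Δ := chamberΔ 1

theorem exists_chamberΔ_eq (t : Triangle Δ) : ∃ g, chamberΔ g = t := by
  obtain ⟨g, hg⟩ := t.2.1.2
  refine ⟨g, Subtype.ext ?_⟩
  exact (Finset.eq_of_subset_of_card_le hg (by rw [card_chamber, t.2.2])).symm

/-- The equivariant marking `π` of the triangles of the development by Pauli matrices:
`π (g t₀) = τ(g)⁻¹ X τ(g)`, which is `X`, `Y` or `Z` according as `τ(g)` is `1`, `T` or `T²`. -/
noncomputable def mark (t : Triangle Δ) : Pauli :=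
  Pauli.next^[(Multiplicative.toAdd (tau (exists_chamberΔ_eq t).choose)).val] Pauli.X

theorem mark_chamberΔ (g : G) :
    mark (chamberΔ g) = Pauli.next^[(Multiplicative.toAdd (tau g)).val] Pauli.X := by
  have h := (exists_chamberΔ_eq (chamberΔ g)).choose_spec
  rw [mark]
  generalize (exists_chamberΔ_eq (chamberΔ g)).choose = k at h
  have h1 : chamber k = chamber g := congrArg Subtype.val h
  have h2 : (⟨Corner.v, QuotientGroup.mk k⟩ : Vertex) ∈ chamber g := by
    rw [← h1]
    exact Finset.mem_map.2 ⟨Corner.v, Finset.mem_univ _, rfl⟩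
  obtain ⟨c, -, hc⟩ := Finset.mem_map.1 h2
  have hcv : c = Corner.v := congrArg Sigma.fst hc
  subst hcv
  have hq : (QuotientGroup.mk g : G ⧸ stab Corner.v) = QuotientGroup.mk k :=
    eq_of_heq (Sigma.mk.inj hc).2
  obtain ⟨x, hx⟩ := QuotientGroup.eq.1 hq
  have hx1 : tau (g⁻¹ * k) = 1 := by
    rw [← hx]
    change freeTau (freeV x) = 1
    simp [freeTau, freeV]
  have : tau k = tau g := by
    rw [map_mul, map_inv, inv_mul_eq_one] at hx1
    exact hx1.symm
  rw [this]

/-! ### Pauli puzzles -/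

/-- A Pauli puzzle: a marking of the faces of the tiled plane by Pauli matrices for which faces
with a common edge have different marks and the cyclic product of the six Pauli matrices around
every vertex is the identity matrix. -/
@[ext]
structure Puzzle where
  tile : Triangle E → Pauli
  adjacent : ∀ F F' : Triangle E, (F.1 ∩ F'.1).card = 2 → tile F ≠ tile F'
  ring : ∀ v : ℤ × ℤ, (List.ofFn fun i : Fin 6 => (tile (around v i)).mat).prod = 1

/-- The Pauli puzzles pointed at the triangle `t` of the barycentric subdivision of `E`: `t` lies
in a face with mark `X`. -/
abbrev PointedPuzzle (t : Triangle (sd E)) : Type :=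
  {p : Puzzle // ∀ F, LiesIn t F → p.tile F = Pauli.X}

/-- The simplicial embeddings of the barycentric subdivision of `E` into the development that
take the triangle `t` to the fundamental triangle. -/
abbrev PointedEmbedding (t : Triangle (sd E)) : Type :=
  {f : SimplicialEmbedding (sd E) Δ // f.mapTriangle t = t₀}

/-- The embedding `f` preserves the Pauli matrices: the mark in the development of the image of a
triangle of the subdivision is the mark in `p` of the face that contains the triangle. -/
def PreservesMarks (p : Puzzle) (f : SimplicialEmbedding (sd E) Δ) : Prop :=
  ∀ (s : Triangle (sd E)) (F : Triangle E), LiesIn s F → mark (f.mapTriangle s) = p.tile F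

end PauliPuzzle

/-! Write `c` for the generator of the edge group `C`. Inside `G` the groups `U`, `V`, `W` meet
pairwise in the edge groups and jointly in 1, so every triangle of the development is `g t₀` for a
unique `g`. An embedding therefore amounts to one element of `G` for each flag of the plane. Types
of vertices are forced: twelve triangles meet at a vertex of the tiling, while `V` and `W` have only
six elements. Neighbouring flags then differ by `X`, by `c`, or by a nontrivial power of `T`, the
last when an edge is crossed. Since `τ` kills `X` and `c`, it is constant on faces and changes
across edges; this is the marking.

Multiplying by the inverse of `T^k`, with `k = τ(g)`, gives elements that depend only on oriented
edges of the tiling. Reversal of an edge is multiplication by `c`, which commutes with `T`; turning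
through a face is multiplication by the Pauli matrix `T^k X T^(-k)`. This is the mark `T^(-k) X T^k`
with `Y` and `Z` exchanged. Six turns around a vertex lead back to the start, so the cyclic product
is trivial; the exchange of `Y` and `Z` is harmless for words of length six.

Conversely, a puzzle prescribes all turns. The vertex condition and the relation `(M c)^3 = 1` for
each Pauli matrix `M` make this a flat connection on the plane, which integrates to a `Flat`
(`exists_flat`). The marks also recover the powers of `T`, whence `embedding_unique`.

The heart is injectivity: distinct vertices of a flat lie in distinct cosets of `U`
(`Flat.eq_of_edge_eq`). Behind it is nonpositive curvature. The Cayley graph of the Pauli group on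
`X`, `Y`, `Z` is bipartite by the determinant and has no 4-cycles, so the triangle complex with
these links has links of girth at least six. Instead of invoking CAT(0) geometry, the complex is
grown explicitly from a root. Its edges are oriented so that in and out alternate around each
vertex; a new vertex is attached either by one edge or by all triangles on one edge. Girth six makes
edge reversal an involution (`flip_flip`) for which all triangles close (`turn_mul_flip_pow_three`),
so `G` acts (`exists_action`). In a flat, every vertex other than the base point has an edge towards
the root, hence is not the root. -/

namespace PauliPuzzle

/-! ### Normal forms -/

/-- A group with a set of involutions whose Cayley graph is bipartite and has no cycles of
length four. -/
structure LetterSystem (A L : Type) [Group A] where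
  letter : L → A
  mul_self : ∀ a, letter a * letter a = 1
  sgn : A →* ℤˣ
  sgn_letter : ∀ a, sgn (letter a) = -1
  reduced : ∀ a b c d, a ≠ b → b ≠ c → c ≠ d →
    letter a * letter b * letter c * letter d ≠ 1

/-- The vertices of the tree of normal forms. A vertex `a x r` lies above `x` on a positive edge,
a vertex `b x s` lies above `x` on a negative edge. -/
inductive Node (A : Type) : Type
  | root
  | a (x : Node A) (r : A)
  | b (x : Node A) (s : A)

namespace LetterSystem

variable {A L : Type} [Group A] (S : LetterSystem A L)

/-- The elements of the group that are letters. -/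
def IsLetter (p : A) : Prop := ∃ N, S.letter N = p

/-- The products of two different letters. -/
def IsPair (p : A) : Prop := ∃ N : L × L, N.1 ≠ N.2 ∧ S.letter N.1 * S.letter N.2 = p

/-- The positive edges that lead away from the root. -/
def UpOut : Node A → A → Prop
  | .root, r => S.sgn r = 1
  | .a _ _, r => S.sgn r = -1
  | .b _ _, r => S.sgn r = 1 ∧ r ≠ 1

/-- The negative edges that lead away from the root. -/
def UpIn : Node A → A → Prop
  | .root, s => S.sgn s = -1
  | .a _ _, s => S.sgn s = 1 ∧ s ≠ 1
  | .b _ _, s => S.sgn s = -1 ∧ ¬ S.IsLetter s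

/-- The negative edges that lead towards the root. -/
def DownIn : Node A → A → Prop
  | .root, _ => False
  | .a _ _, p => p = 1
  | .b _ _, p => S.IsLetter p

/-- The positive edges that lead away from the root to a vertex below which there is no other
edge. -/
def Tail : Node A → A → Prop
  | .root, r => S.sgn r = 1
  | .a _ _, r => S.sgn r = -1 ∧ ¬ S.IsLetter r
  | .b _ _, r => S.sgn r = 1 ∧ r ≠ 1 ∧ ¬ S.IsPair r

/-- The nodes that are normal forms. -/
def Valid : Node A → Prop
  | .root => True
  | .a x r => Valid x ∧ S.Tail x r
  | .b x s => Valid x ∧ S.UpIn x s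

open Classical in
/-- The reversal of edges: the edge `p` at the vertex `x` is sent to the same edge with the
opposite orientation. -/
noncomputable def flip : Node A → A → Node A × A
  | .root, p => if S.sgn p = 1 then (.a .root p, 1) else (.b .root p, 1)
  | .a x r, p =>
    if p = 1 then (x, r)
    else if S.IsLetter p then (.b x (r * p), p)
    else if S.sgn p = -1 then (.a (.a x r) p, 1) else (.b (.a x r) p, 1)
  | .b x s, p =>
    if p = 1 then (x, s)
    else if S.IsLetter p then ((flip x (s * p)).1, (flip x (s * p)).2 * p)
    else if h : S.IsPair p then
      (.b (flip x (s * S.letter h.choose.1)).1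
        ((flip x (s * S.letter h.choose.1)).2 * S.letter h.choose.1 * S.letter h.choose.2),
        S.letter h.choose.2)
    else if S.sgn p = 1 then (.a (.b x s) p, 1) else (.b (.b x s) p, 1)

variable {S}

/-! ### Consequences of the absence of 4-cycles -/

@[simp]
theorem letter_mul_cancel (p : A) (N : L) : p * S.letter N * S.letter N = p := by
  rw [mul_assoc, S.mul_self, mul_one]

theorem neg_one_ne_one_units : (-1 : ℤˣ) ≠ 1 := by decide

theorem sgn_cases (p : A) : S.sgn p = 1 ∨ S.sgn p = -1 := Int.units_eq_one_or _

theorem sgn_mul_letter (p : A) (N : L) : S.sgn (p * S.letter N) = - S.sgn p := by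
  rw [map_mul, S.sgn_letter, mul_neg_one]

theorem letter_ne_one (N : L) : S.letter N ≠ 1 := fun h => by
  have := S.sgn_letter N
  rw [h, map_one] at this
  exact neg_one_ne_one_units this.symm

theorem letter_injective : Function.Injective S.letter := by
  intro N K h
  by_contra hne
  apply S.reduced N K N K hne (Ne.symm hne) hne
  rw [h, S.mul_self, one_mul, S.mul_self]

theorem mul_letter_eq_iff {p q : A} {N : L} : p * S.letter N = q ↔ p = q * S.letter N := by
  constructor
  · rintro rfl; simp
  · rintro rfl; simp

theorem letter_mul_letter_ne_one {N K : L} (h : N ≠ K) : S.letter N * S.letter K ≠ 1 := by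
  rw [Ne, mul_letter_eq_iff, one_mul]
  exact fun h' => h (letter_injective h')

/-- An equation `N K M = J` closes a path of length four in the Cayley graph. It is excluded by
`reduced`, or shortens to `N K = 1` when `J = M`. -/
theorem not_isLetter_three {N K M : L} (h : N ≠ K) (h' : K ≠ M) :
    ¬ S.IsLetter (S.letter N * S.letter K * S.letter M) := by
  rintro ⟨J, hJ⟩
  by_cases hMJ : M = J
  · subst hMJ
    have := mul_letter_eq_iff.1 hJ.symm
    rw [S.mul_self] at this
    exact letter_mul_letter_ne_one h this
  · apply S.reduced N K M J h h' hMJ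
    rw [← hJ, S.mul_self]

/-- Different last letters would express `N` as the product `N' K' K` of three letters. Uniqueness
makes the choice in the `IsPair` branch of `flip` harmless. -/
theorem pair_unique {N K N' K' : L} (h' : N' ≠ K')
    (he : S.letter N * S.letter K = S.letter N' * S.letter K') : N = N' ∧ K = K' := by
  replace he := mul_letter_eq_iff.1 he
  by_cases hK : K = K'
  · subst hK
    simp only [letter_mul_cancel] at he
    exact ⟨letter_injective he, rfl⟩
  · exact absurd ⟨N, he⟩ (not_isLetter_three h' (Ne.symm hK))

theorem not_isLetter_of_sgn {p : A} (h : S.sgn p = 1) : ¬ S.IsLetter p := by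
  rintro ⟨N, rfl⟩
  rw [S.sgn_letter] at h
  exact neg_one_ne_one_units h

theorem sgn_pair {N K : L} : S.sgn (S.letter N * S.letter K) = 1 := by
  rw [sgn_mul_letter, S.sgn_letter, neg_neg]

theorem not_isPair_of_sgn {p : A} (h : S.sgn p = -1) : ¬ S.IsPair p := by
  rintro ⟨N, -, rfl⟩
  rw [sgn_pair] at h
  exact neg_one_ne_one_units h.symm

theorem ne_one_of_sgn {p : A} (h : S.sgn p = -1) : p ≠ 1 := by
  rintro rfl
  rw [map_one] at h
  exact neg_one_ne_one_units h.symm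

/-! ### Values of the edge reversal -/

theorem flip_one_a (x : Node A) (r : A) : S.flip (.a x r) 1 = (x, r) := by simp [flip]

theorem flip_one_b (x : Node A) (r : A) : S.flip (.b x r) 1 = (x, r) := by simp [flip]

/-- This edge is the third side of the triangle spanned at `x` by the edges `r` and `r * S.letter
N`. -/
theorem flip_letter_a (x : Node A) (r : A) (N : L) :
    S.flip (.a x r) (S.letter N) = (.b x (r * S.letter N), S.letter N) := by
  rw [flip, if_neg (letter_ne_one N), if_pos ⟨N, rfl⟩]

theorem flip_letter_b (x : Node A) (s : A) (N : L) :
    S.flip (.b x s) (S.letter N) =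
      ((S.flip x (s * S.letter N)).1, (S.flip x (s * S.letter N)).2 * S.letter N) := by
  rw [flip, if_neg (letter_ne_one N), if_pos ⟨N, rfl⟩]

/-- The downward edge `N` at `b x s` ends at the far end `v` of the edge `s * S.letter N` of `x`.
The edge `N K` is next to it in the link, so it is the side opposite to `v` in a triangle, and its
far end is a new `b` vertex above `v`. -/
theorem flip_pair_b (x : Node A) (s : A) {N K : L} (h : N ≠ K) :
    S.flip (.b x s) (S.letter N * S.letter K) =
      (.b (S.flip x (s * S.letter N)).1
        ((S.flip x (s * S.letter N)).2 * S.letter N * S.letter K), S.letter K) := by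
  have hp : S.IsPair (S.letter N * S.letter K) := ⟨(N, K), h, rfl⟩
  obtain ⟨h1, h2⟩ := pair_unique h hp.choose_spec.2
  rw [flip, if_neg (letter_mul_letter_ne_one h), if_neg (not_isLetter_of_sgn sgn_pair),
    dif_pos hp, h1, h2]

theorem flip_tail {x : Node A} {r : A} (h : S.Tail x r) : S.flip x r = (.a x r, 1) := by
  cases x with
  | root => rw [flip, if_pos (show S.sgn r = 1 from h)]
  | a x q => rw [flip, if_neg (ne_one_of_sgn h.1), if_neg h.2, if_pos h.1]
  | b x q => rw [flip, if_neg h.2.1, if_neg (not_isLetter_of_sgn h.1), dif_neg h.2.2, if_pos h.1]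

theorem flip_upIn {x : Node A} {s : A} (h : S.UpIn x s) : S.flip x s = (.b x s, 1) := by
  cases x with
  | root => rw [flip, if_neg]; rw [show S.sgn s = -1 from h]; exact neg_one_ne_one_units
  | a x q =>
    rw [flip, if_neg h.2, if_neg (not_isLetter_of_sgn h.1), if_neg]
    rw [h.1]; exact neg_one_ne_one_units.symm
  | b x q =>
    rw [flip, if_neg (ne_one_of_sgn h.1), if_neg h.2, dif_neg (not_isPair_of_sgn h.1), if_neg]
    rw [h.1]; exact neg_one_ne_one_units

/-! ### Upward and downward edges in the link of a vertex -/

/-- Every triangle on an upward negative edge has its other side at `x` upward too, so `x` is its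
lowest vertex. -/
theorem UpIn.upOut {x : Node A} {s : A} (h : S.UpIn x s) (N : L) :
    S.UpOut x (s * S.letter N) := by
  cases x with
  | root =>
    change S.sgn _ = 1
    rw [sgn_mul_letter, show S.sgn s = -1 from h, neg_neg]
  | a x q =>
    change S.sgn _ = -1
    rw [sgn_mul_letter, h.1]
  | b x q =>
    refine ⟨by rw [sgn_mul_letter, h.1, neg_neg], fun h1 => h.2 ⟨N, ?_⟩⟩
    rw [mul_letter_eq_iff, one_mul] at h1
    exact h1.symm

/-- A tail is by definition an upward edge that is not adjacent in the link to a negative downward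
edge. -/
theorem Tail.upIn {x : Node A} {r : A} (h : S.Tail x r) (N : L) :
    S.UpIn x (r * S.letter N) := by
  cases x with
  | root =>
    change S.sgn _ = -1
    rw [sgn_mul_letter, show S.sgn r = 1 from h]
  | a x q =>
    refine ⟨by rw [sgn_mul_letter, h.1, neg_neg], fun h1 => h.2 ⟨N, ?_⟩⟩
    rw [mul_letter_eq_iff, one_mul] at h1
    exact h1.symm
  | b x q =>
    refine ⟨by rw [sgn_mul_letter, h.1], ?_⟩
    rintro ⟨K, hK⟩
    have h1 := mul_letter_eq_iff.1 hK.symm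
    have hKN : K ≠ N := by
      rintro rfl
      exact h.2.1 (by rw [h1, S.mul_self])
    exact h.2.2 ⟨(K, N), hKN, h1.symm⟩

theorem Tail.upOut {x : Node A} {r : A} (h : S.Tail x r) : S.UpOut x r := by
  cases x with
  | root => exact h
  | a x q => exact h.1
  | b x q => exact ⟨h.1, h.2.1⟩

/-- A positive edge upwards either is a tail or is adjacent to a negative edge downwards. -/
theorem UpOut.cases {x : Node A} {r : A} (h : S.UpOut x r) :
    S.Tail x r ∨ (∃ y q N, x = .a y q ∧ r = S.letter N) ∨
      ∃ y s N K, x = .b y s ∧ N ≠ K ∧ r = S.letter N * S.letter K := by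
  cases x with
  | root => exact Or.inl h
  | a y q =>
    by_cases hr : S.IsLetter r
    · obtain ⟨N, rfl⟩ := hr
      exact Or.inr (Or.inl ⟨y, q, N, rfl, rfl⟩)
    · exact Or.inl ⟨h, hr⟩
  | b y s =>
    by_cases hr : S.IsPair r
    · obtain ⟨N, hN, rfl⟩ := hr
      exact Or.inr (Or.inr ⟨y, s, N.1, N.2, rfl, hN, rfl⟩)
    · exact Or.inl ⟨h.1, h.2, hr⟩

/-- At a `b` vertex `t` is a letter `M`, and `M N K` is not a letter as soon as `M ≠ N`. The
hypothesis `hN` says precisely this: the first turn must not reach the second kind of downward edge,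
which is 1. -/
theorem DownIn.upIn {v : Node A} {t : A} {N K : L} (h : S.DownIn v t)
    (hN : t * S.letter N ≠ 1) (hNK : N ≠ K) : S.UpIn v (t * S.letter N * S.letter K) := by
  cases v with
  | root => exact h.elim
  | a y q =>
    obtain rfl : t = 1 := h
    rw [one_mul]
    exact ⟨sgn_pair, letter_mul_letter_ne_one hNK⟩
  | b y s =>
    obtain ⟨M, rfl⟩ := h
    refine ⟨by rw [sgn_mul_letter, sgn_pair], not_isLetter_three ?_ hNK⟩
    rintro rfl
    exact hN (S.mul_self M)

/-- The involution property on the downward edges of a `b` vertex. If `s * S.letter N` is a tail,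
the neighbour is an `a` vertex directly above `y`. Otherwise that edge is adjacent to a downward
edge of `y`, and the claim descends to the vertex below; there `K = N` (or `K' = N`) would make `s`
itself a downward edge. -/
theorem flip_flip_letter_b (y : Node A) (hy : S.Valid y) (s : A) (hs : S.UpIn y s) (N : L) :
    S.flip (S.flip y (s * S.letter N)).1 ((S.flip y (s * S.letter N)).2 * S.letter N) =
      (.b y s, S.letter N) := by
  induction y generalizing s N with
  | root =>
    rw [flip_tail (x := .root) (hs.upOut N)]
    rw [one_mul, flip_letter_a, letter_mul_cancel]
  | a z q ih =>
    rcases (hs.upOut N).cases with h | ⟨y, q', K, he, hK⟩ | ⟨y, q', K, K', he, -⟩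
    · rw [flip_tail h, one_mul, flip_letter_a, letter_mul_cancel]
    · have hsK := mul_letter_eq_iff.1 hK
      have hKN : K ≠ N := by
        rintro rfl
        exact hs.2 (by rw [hsK, S.mul_self])
      rw [hK, flip_letter_a]
      simp only
      rw [flip_pair_b _ _ hKN, letter_mul_cancel, flip_tail hy.2]
      simp only
      rw [one_mul, ← hsK]
    · cases he
  | b z s' ih =>
    rcases (hs.upOut N).cases with h | ⟨y, q', K, he, hK⟩ | ⟨y, q', K, K', he, hne, hK⟩
    · rw [flip_tail h, one_mul, flip_letter_a, letter_mul_cancel]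
    · cases he
    · have hsK := mul_letter_eq_iff.1 hK
      have hKN : K' ≠ N := by
        rintro rfl
        exact hs.2 ⟨K, by rw [hsK, letter_mul_cancel]⟩
      rw [hK, flip_pair_b _ _ hne]
      simp only
      rw [flip_pair_b _ _ hKN, letter_mul_cancel, ih hy.1 s' hy.2 K]
      simp only
      rw [← hsK]

/-- The last clause is carried through the induction because `DownIn.upIn` needs it: a triangle with
lowest vertex `x` is not a triangle on the edge along which the far end of `r` was attached. -/
theorem flip_upOut (x : Node A) (hx : S.Valid x) (r : A) (hr : S.UpOut x r) :
    S.Valid (S.flip x r).1 ∧ S.DownIn (S.flip x r).1 (S.flip x r).2 ∧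
      S.flip (S.flip x r).1 (S.flip x r).2 = (x, r) ∧
      ∀ N, S.UpIn x (r * S.letter N) → (S.flip x r).2 * S.letter N ≠ 1 := by
  induction x generalizing r with
  | root =>
    rw [flip_tail (x := .root) hr]
    exact ⟨⟨hx, hr⟩, rfl, flip_one_a _ _, fun N _ => by rw [one_mul]; exact letter_ne_one N⟩
  | a y q ih =>
    rcases hr.cases with h | ⟨y', q', N, he, rfl⟩ | ⟨y', q', K, K', he, -⟩
    · rw [flip_tail h]
      exact ⟨⟨hx, h⟩, rfl, flip_one_a _ _, fun N _ => by rw [one_mul]; exact letter_ne_one N⟩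
    · rw [flip_letter_a]
      refine ⟨⟨hx.1, hx.2.upIn N⟩, ⟨N, rfl⟩, ?_, fun M hM => hM.2⟩
      rw [flip_letter_b, letter_mul_cancel, flip_tail hx.2, one_mul]
    · cases he
  | b y s ih =>
    rcases hr.cases with h | ⟨y', q', N, he, rfl⟩ | ⟨y', q', N, K, he, hne, rfl⟩
    · rw [flip_tail h]
      exact ⟨⟨hx, h⟩, rfl, flip_one_a _ _, fun N _ => by rw [one_mul]; exact letter_ne_one N⟩
    · cases he
    · obtain ⟨h1, h2, h3, h4⟩ := ih hx.1 _ (hx.2.upOut N)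
      have h5 := h4 N (by rw [letter_mul_cancel]; exact hx.2)
      rw [flip_pair_b _ _ hne]
      -- If `K M = 1`, the supposedly upward edge `N K M` is the letter `N`, which leads down from a
      -- `b` vertex.
      refine ⟨⟨h1, h2.upIn h5 hne⟩, ⟨K, rfl⟩, ?_, fun M hM hM1 => hM.2 ⟨N, ?_⟩⟩
      · rw [flip_letter_b, letter_mul_cancel, flip_flip_letter_b y hx.1 s hx.2 N]
      · rw [mul_assoc, hM1, mul_one]

/-- Every edge leads up or down. -/
theorem edge_cases (x : Node A) (p : A) :
    S.UpOut x p ∨ S.UpIn x p ∨ S.DownIn x p ∨ ∃ y s, x = .b y s ∧ p = 1 := by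
  cases x with
  | root => exact (sgn_cases p).imp id Or.inl
  | a y q =>
    rcases sgn_cases (S := S) p with h | h
    · by_cases h1 : p = 1
      · exact Or.inr (Or.inr (Or.inl h1))
      · exact Or.inr (Or.inl ⟨h, h1⟩)
    · exact Or.inl h
  | b y s =>
    rcases sgn_cases (S := S) p with h | h
    · by_cases h1 : p = 1
      · exact Or.inr (Or.inr (Or.inr ⟨y, s, rfl, h1⟩))
      · exact Or.inl ⟨h, h1⟩
    · by_cases h1 : S.IsLetter p
      · exact Or.inr (Or.inr (Or.inl h1))
      · exact Or.inr (Or.inl ⟨h, h1⟩)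

theorem flip_downIn {x : Node A} (hx : S.Valid x) {p : A} (hp : S.DownIn x p) :
    S.Valid (S.flip x p).1 ∧ S.UpOut (S.flip x p).1 (S.flip x p).2 ∧
      S.flip (S.flip x p).1 (S.flip x p).2 = (x, p) := by
  cases x with
  | root => exact hp.elim
  | a y q =>
    obtain rfl : p = 1 := hp
    rw [flip_one_a]
    exact ⟨hx.1, hx.2.upOut, flip_tail hx.2⟩
  | b y s =>
    obtain ⟨N, rfl⟩ := hp
    obtain ⟨h1, h2, h3, h4⟩ := flip_upOut y hx.1 _ (hx.2.upOut N)
    have h5 := h4 N (by rw [letter_mul_cancel]; exact hx.2)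
    rw [flip_letter_b]
    refine ⟨h1, ?_, flip_flip_letter_b y hx.1 s hx.2 N⟩
    generalize S.flip y (s * S.letter N) = w at *
    obtain ⟨v, t⟩ := w
    cases v with
    | root => exact h2.elim
    | a z q =>
      obtain rfl : t = 1 := h2
      rw [one_mul]
      exact S.sgn_letter N
    | b z q =>
      obtain ⟨K, rfl⟩ := h2
      exact ⟨sgn_pair, h5⟩

theorem valid_flip {x : Node A} (hx : S.Valid x) (p : A) : S.Valid (S.flip x p).1 := by
  rcases edge_cases (S := S) x p with h | h | h | ⟨y, s, rfl, rfl⟩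
  · exact (flip_upOut x hx p h).1
  · rw [flip_upIn h]; exact ⟨hx, h⟩
  · exact (flip_downIn hx h).1
  · rw [flip_one_b]; exact hx.1

theorem flip_flip {x : Node A} (hx : S.Valid x) (p : A) :
    S.flip (S.flip x p).1 (S.flip x p).2 = (x, p) := by
  rcases edge_cases (S := S) x p with h | h | h | ⟨y, s, rfl, rfl⟩
  · exact (flip_upOut x hx p h).2.2.1
  · rw [flip_upIn h, flip_one_b]
  · exact (flip_downIn hx h).2.2
  · rw [flip_one_b, flip_upIn hx.2]

/-! ### Triangles of the complex of normal forms -/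

variable (S)

/-- The oriented edges of the complex of normal forms. -/
abbrev Edge : Type := {x : Node A // S.Valid x} × A

/-- The reversal of edges as a permutation. -/
noncomputable def flipEquiv : Equiv.Perm S.Edge :=
  Function.Involutive.toPerm
    (fun e => (⟨(S.flip e.1.1 e.2).1, valid_flip e.1.2 e.2⟩, (S.flip e.1.1 e.2).2))
    (fun e => by
      have h := flip_flip e.1.2 e.2
      refine Prod.ext (Subtype.ext ?_) ?_
      · exact congrArg Prod.fst h
      · change (S.flip (S.flip e.1.1 e.2).1 (S.flip e.1.1 e.2).2).2 = e.2
        rw [h])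

/-- The rotation about the origin of an edge by a letter. -/
def turnEquiv (N : L) : Equiv.Perm S.Edge where
  toFun e := (e.1, e.2 * S.letter N)
  invFun e := (e.1, e.2 * S.letter N)
  left_inv e := by simp
  right_inv e := by simp

variable {S}

theorem flipEquiv_mul_self : S.flipEquiv * S.flipEquiv = 1 :=
  Equiv.ext fun e => S.flipEquiv.left_inv e

theorem turnEquiv_mul_self (N : L) : S.turnEquiv N * S.turnEquiv N = 1 :=
  Equiv.ext fun e => (S.turnEquiv N).left_inv e

/-- The three steps run around the triangle with lowest vertex `x`, whose other vertices are `b x s`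
and the far end of `s * S.letter N`. -/
theorem pow_three_fix_of_upIn (N : L) (x : {x : Node A // S.Valid x}) (s : A)
    (h : S.UpIn x.1 s) : ((S.turnEquiv N * S.flipEquiv) ^ 3) (x, s) = (x, s) := by
  have h1 : (S.turnEquiv N * S.flipEquiv) (x, s) =
      (⟨.b x.1 s, x.2, h⟩, S.letter N) := by
    refine Prod.ext (Subtype.ext ?_) ?_
    · exact congrArg Prod.fst (flip_upIn h)
    · change (S.flip x.1 s).2 * _ = _
      rw [flip_upIn h, one_mul]
  have h2 : (S.turnEquiv N * S.flipEquiv) (⟨.b x.1 s, x.2, h⟩, S.letter N) =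
      S.flipEquiv (x, s * S.letter N) := by
    refine Prod.ext (Subtype.ext ?_) ?_
    · change (S.flip _ _).1 = (S.flip x.1 (s * S.letter N)).1
      rw [flip_letter_b]
    · change (S.flip _ _).2 * _ = _
      rw [flip_letter_b, letter_mul_cancel]
      rfl
  have h3 : (S.turnEquiv N * S.flipEquiv) (S.flipEquiv (x, s * S.letter N)) = (x, s) := by
    rw [Equiv.Perm.mul_apply, ← Equiv.Perm.mul_apply S.flipEquiv, flipEquiv_mul_self]
    exact Prod.ext rfl (letter_mul_cancel _ _)
  rw [pow_three]
  change (S.turnEquiv N * S.flipEquiv) ((S.turnEquiv N * S.flipEquiv)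
    ((S.turnEquiv N * S.flipEquiv) (x, s))) = _
  rw [h1, h2, h3]

/-- Conjugation by either involution inverts `(n * c) ^ 3`, so its fixed points are stable under `n`
and `c`. It is therefore enough to test one oriented edge of each triangle. -/
theorem pow_three_fix_iff {Ω : Type} {n c : Equiv.Perm Ω} (hn : n * n = 1) (hc : c * c = 1)
    (e : Ω) : (((n * c) ^ 3) (n e) = n e ↔ ((n * c) ^ 3) e = e) ∧
      (((n * c) ^ 3) (c e) = c e ↔ ((n * c) ^ 3) e = e) := by
  have hn' : n⁻¹ = n := inv_eq_of_mul_eq_one_left hn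
  have hc' : c⁻¹ = c := inv_eq_of_mul_eq_one_left hc
  have key : ∀ m : Equiv.Perm Ω, m * (n * c) ^ 3 * m = ((n * c) ^ 3)⁻¹ → m * m = 1 →
      (((n * c) ^ 3) (m e) = m e ↔ ((n * c) ^ 3) e = e) := by
    intro m hm hm1
    have hm2 : m⁻¹ = m := inv_eq_of_mul_eq_one_left hm1
    have : (n * c) ^ 3 * m = m * ((n * c) ^ 3)⁻¹ := by
      rw [← hm, ← mul_assoc, ← mul_assoc, hm1, one_mul]
    rw [← Equiv.Perm.mul_apply, this, Equiv.Perm.mul_apply, m.apply_eq_iff_eq,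
      Equiv.Perm.inv_eq_iff_eq, eq_comm]
  refine ⟨key n ?_ hn, key c ?_ hc⟩
  · rw [← inv_pow, mul_inv_rev, hn', hc']
    simp only [pow_three, ← mul_assoc, hn, one_mul]
  · rw [← inv_pow, mul_inv_rev, hn', hc']
    simp only [pow_three, mul_assoc, hc, mul_one]

/-- Turns by `N` and reversals bring every oriented edge to the upward negative edge at the lowest
vertex of its triangle, where the relation has been verified. -/
theorem turn_mul_flip_pow_three (N : L) : (S.turnEquiv N * S.flipEquiv) ^ 3 = 1 := by
  have hiff := fun e => pow_three_fix_iff (turnEquiv_mul_self (S := S) N) flipEquiv_mul_self e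
  have hdown : ∀ (x : {x : Node A // S.Valid x}) (p : A), S.DownIn x.1 p →
      ((S.turnEquiv N * S.flipEquiv) ^ 3) (x, p) = (x, p) := by
    rintro ⟨x, hx⟩ p hp
    cases x with
    | root => exact hp.elim
    | a y q =>
      obtain rfl : p = 1 := hp
      rw [← (hiff _).2, ← (hiff _).1]
      apply pow_three_fix_of_upIn
      change S.UpIn (S.flip (.a y q) 1).1 ((S.flip (.a y q) 1).2 * S.letter N)
      rw [flip_one_a]
      exact hx.2.upIn N
    | b y s =>
      obtain ⟨K, rfl⟩ := hp
      by_cases hKN : K = N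
      · subst hKN
        rw [← (hiff _).1, ← (hiff _).2]
        apply pow_three_fix_of_upIn
        change S.UpIn (S.flip (.b y s) (S.letter K * S.letter K)).1
          (S.flip (.b y s) (S.letter K * S.letter K)).2
        rw [S.mul_self, flip_one_b]
        exact hx.2
      -- For `K ≠ N` the lowest vertex of the triangle is the far end of the downward edge `K`.
      · obtain ⟨h1, h2, h3, h4⟩ := flip_upOut y hx.1 _ (hx.2.upOut K)
        have h5 := h4 K (by rw [letter_mul_cancel]; exact hx.2)
        rw [← (hiff _).2, ← (hiff _).1]
        apply pow_three_fix_of_upIn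
        change S.UpIn (S.flip (.b y s) (S.letter K)).1
          ((S.flip (.b y s) (S.letter K)).2 * S.letter N)
        rw [flip_letter_b]
        exact h2.upIn h5 hKN
  apply Equiv.ext
  rintro ⟨x, p⟩
  rw [Equiv.Perm.one_apply]
  rcases edge_cases (S := S) x.1 p with h | h | h | ⟨y, s, hxy, rfl⟩
  · rw [← (hiff _).2]
    exact hdown _ _ (flip_upOut x.1 x.2 p h).2.1
  · exact pow_three_fix_of_upIn N x p h
  · exact hdown x p h
  · obtain ⟨x, hx⟩ := x
    obtain rfl : x = _ := hxy
    rw [← (hiff _).2]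
    apply pow_three_fix_of_upIn
    change S.UpIn (S.flip (.b y s) 1).1 (S.flip (.b y s) 1).2
    rw [flip_one_b]
    exact hx.2

end LetterSystem


/-! ### Words in the Pauli matrices -/

instance : Fintype Pauli := ⟨{.X, .Y, .Z}, fun k => by cases k <;> simp⟩

/-- Right multiplication of a matrix `i ^ k M`, with `M` a Pauli matrix or the identity, by a
Pauli matrix. -/
def wordStep : ZMod 4 × Option Pauli → Pauli → ZMod 4 × Option Pauli
  | (k, none), M => (k, some M)
  | (k, some N), M =>
    if N = M then (k, none)
    else if N.next = M then (k + 1, some M.next) else (k + 3, some N.next)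

/-- The value of a word in the Pauli matrices. -/
def evalWord (w : List Pauli) : ZMod 4 × Option Pauli := w.foldl wordStep (0, none)

/-- The matrix `i ^ k M`. -/
noncomputable def stateMat (s : ZMod 4 × Option Pauli) : Matrix (Fin 2) (Fin 2) ℂ :=
  Complex.I ^ s.1.val • s.2.elim 1 Pauli.mat

theorem stateMat_wordStep (s : ZMod 4 × Option Pauli) (M : Pauli) :
    stateMat (wordStep s M) = stateMat s * M.mat := by
  obtain ⟨k, N⟩ := s
  have hI : ∀ j : ZMod 4, Complex.I ^ (k + j).val = Complex.I ^ k.val * Complex.I ^ j.val := by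
    intro j
    rw [ZMod.val_add, ← pow_add]
    exact (pow_eq_pow_mod _ Complex.I_pow_four).symm
  have h1 : (1 : ZMod 4).val = 1 := rfl
  have h3 : (3 : ZMod 4).val = 3 := rfl
  have h4 : Complex.I ^ 3 = -Complex.I := by rw [pow_succ, Complex.I_sq]; ring
  cases N with
  | none => simp [wordStep, stateMat]
  | some N =>
    cases N <;> cases M <;>
      simp only [wordStep, stateMat, Pauli.next, reduceCtorEq, if_true, if_false, hI, h1, h3, h4,
        pow_one, Option.elim, mul_smul, Matrix.smul_mul] <;> congr 1 <;> ext i j <;>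
      fin_cases i <;> fin_cases j <;> simp [Pauli.mat]

theorem stateMat_eq_one {s : ZMod 4 × Option Pauli} (h : stateMat s = 1) : s = (0, none) := by
  obtain ⟨k, N⟩ := s
  have h00 := congrFun (congrFun h 0) 0
  have h11 := congrFun (congrFun h 1) 1
  have h4 : Complex.I ^ 3 = -Complex.I := by rw [pow_succ, Complex.I_sq]; ring
  have hv2 : (2 : ZMod 4).val = 2 := rfl
  have hv3 : (3 : ZMod 4).val = 3 := rfl
  have hv1 : (1 : ZMod 4).val = 1 := rfl
  have hv0 : (0 : ZMod 4).val = 0 := rfl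
  have hk : k = 0 ∨ k = 1 ∨ k = 2 ∨ k = 3 :=
    (by decide : ∀ k : ZMod 4, k = 0 ∨ k = 1 ∨ k = 2 ∨ k = 3) k
  rcases N with _ | N
  · rcases hk with rfl | rfl | rfl | rfl
    · rfl
    all_goals
      exfalso
      simp [stateMat, hv1, hv2, hv3, h4, Complex.ext_iff] at h00
      try norm_num at h00
  · exfalso
    cases N
    · simp [stateMat, Pauli.mat] at h00
    · simp [stateMat, Pauli.mat] at h00
    · simp only [stateMat, Pauli.mat, Option.elim, Matrix.smul_apply, Matrix.of_apply,
        Matrix.cons_val_zero, Matrix.cons_val_one, smul_eq_mul, mul_one,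
        Matrix.one_apply_eq, Matrix.cons_val', Matrix.cons_val_fin_one] at h00 h11
      rw [h00] at h11
      norm_num at h11

/-- This turns identities between complex matrices into computations in a finite set, where `decide`
applies. -/
theorem prod_mat_eq_one_iff (w : List Pauli) :
    (w.map Pauli.mat).prod = 1 ↔ evalWord w = (0, none) := by
  have key : ∀ (w : List Pauli) (s : ZMod 4 × Option Pauli),
      stateMat (w.foldl wordStep s) = stateMat s * (w.map Pauli.mat).prod := by
    intro w
    induction w with
    | nil => simp
    | cons M w ih => intro s; simp [ih, stateMat_wordStep, mul_assoc]
  have h0 : stateMat (0, none) = 1 := by simp [stateMat]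
  have h := key w (0, none)
  rw [h0, one_mul] at h
  rw [← h]
  exact ⟨stateMat_eq_one, fun h1 => (congrArg stateMat h1).trans h0⟩

/-- The transposition of `Y` and `Z`. -/
def Pauli.swapYZ : Pauli → Pauli
  | .X => .X
  | .Y => .Z
  | .Z => .Y

theorem Pauli.swapYZ_swapYZ (M : Pauli) : M.swapYZ.swapYZ = M := by cases M <;> rfl

-- Conjugation by `(Y + Z) / √2` exchanges `Y` and `Z` and sends `X` to `-X`. If a word of length
-- six has scalar value, the numbers of `X`, `Y` and `Z` have the same parity, hence are all even,
-- and the sign disappears. The proof checks all words.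
set_option maxRecDepth 100000 in
theorem evalWord_swapYZ : ∀ a b c d e f : Pauli, evalWord [a, b, c, d, e, f] = (0, none) →
    evalWord [a.swapYZ, b.swapYZ, c.swapYZ, d.swapYZ, e.swapYZ, f.swapYZ] = (0, none) := by
  decide

/-- By parity, the only words of this kind with scalar value are `N M N M` with `N ≠ M`, and these
have value `-1`. -/
theorem evalWord_reduced : ∀ a b c d : Pauli, a ≠ b → b ≠ c → c ≠ d →
    evalWord [a, b, c, d] ≠ (0, none) := by
  decide

theorem coe_toP_list_prod (w : List Pauli) :
    ((w.map Pauli.toP).prod : P).1.1 = (w.map Pauli.mat).prod := by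
  induction w with
  | nil => rfl
  | cons M w ih =>
    rw [List.map_cons, List.prod_cons, List.map_cons, List.prod_cons, ← ih]
    rfl

theorem toP_list_prod_eq_one_iff (w : List Pauli) :
    (w.map Pauli.toP).prod = 1 ↔ (w.map Pauli.mat).prod = 1 := by
  rw [← coe_toP_list_prod]
  constructor
  · intro h; rw [h]; rfl
  · intro h; exact Subtype.ext (Subtype.ext h)

theorem toP_mul_self (M : Pauli) : M.toP * M.toP = 1 := by
  have h := (toP_list_prod_eq_one_iff [M, M]).2
    ((prod_mat_eq_one_iff _).2 (by cases M <;> decide))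
  simpa using h

theorem det_mem_P (p : P) : p.1.1.det = 1 ∨ p.1.1.det = -1 := by
  obtain ⟨p, hp⟩ := p
  change p.1.det = 1 ∨ p.1.det = -1
  induction hp using Subgroup.closure_induction with
  | mem x hx =>
    obtain ⟨M, rfl⟩ := hx
    right
    cases M <;> simp [Pauli.unitary, Pauli.mat, Matrix.det_fin_two]
  | one => left; simp
  | mul x y _ _ hx hy =>
    have : (x * y).1.det = x.1.det * y.1.det := Matrix.det_mul _ _
    rw [this]
    rcases hx with h | h <;> rcases hy with h' | h' <;> simp [h, h']
  | inv x _ hx =>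
    have : x.1.det * (x⁻¹).1.det = 1 := by
      rw [← Matrix.det_mul]
      have : x.1 * (x⁻¹).1 = 1 := congrArg Subtype.val (mul_inv_cancel x)
      rw [this, Matrix.det_one]
    rcases hx with h | h
    · left; simpa [h] using this
    · right; rw [h] at this; linear_combination -this

open Classical in
/-- The determinant as a sign. -/
noncomputable def detSign : P →* ℤˣ :=
  MonoidHom.mk' (fun p => if p.1.1.det = 1 then 1 else -1) (by
    intro x y
    have h : (x * y).1.1.det = x.1.1.det * y.1.1.det := Matrix.det_mul _ _
    have h1 : (-1 : ℂ) ≠ 1 := by norm_num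
    rw [h]
    rcases det_mem_P x with hx | hx <;> rcases det_mem_P y with hy | hy <;>
      simp [hx, hy, h1])

/-- The Pauli matrices as letters. -/
noncomputable def pauliSystem : LetterSystem P Pauli where
  letter := Pauli.toP
  mul_self := toP_mul_self
  sgn := detSign
  sgn_letter M := by
    have h : M.toP.1.1.det = -1 := by
      cases M <;> simp [Pauli.toP, Pauli.unitary, Pauli.mat, Matrix.det_fin_two]
    have h1 : (-1 : ℂ) ≠ 1 := by norm_num
    simp [detSign, h, h1]
  reduced a b c d hab hbc hcd h := by
    apply evalWord_reduced a b c d hab hbc hcd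
    rw [← prod_mat_eq_one_iff, ← toP_list_prod_eq_one_iff]
    simpa [mul_assoc] using h

/-! ### The local groups in the direct limit -/

/-- The canonical map of `U` to `G`. -/
noncomputable def inU : U →* G := toG.comp freeU

/-- The canonical map of `V` to `G`. -/
noncomputable def inV : V →* G := toG.comp freeV

/-- The canonical map of `W` to `G`. -/
noncomputable def inW : W →* G := toG.comp freeW

/-- The generator of the edge group `C`. -/
noncomputable def cG : G := inV (Equiv.swap 1 2)

theorem toG_eq_of_mem {x y : FreeProd} (h : x * y⁻¹ ∈ identifications) : toG x = toG y := by
  have : toG (x * y⁻¹) = 1 := (QuotientGroup.eq_one_iff _).2 (Subgroup.subset_normalClosure h)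
  have h2 : toG x = toG (x * y⁻¹) * toG y := by
    rw [← map_mul]
    exact congrArg toG (inv_mul_cancel_right x y).symm
  rw [h2, this, one_mul]

theorem inU_T : inU T = inW (Multiplicative.ofAdd 2) :=
  toG_eq_of_mem (Or.inl rfl)

theorem inU_X : inU Pauli.X.toU = inV (Equiv.swap 0 1) :=
  toG_eq_of_mem (Or.inr (Or.inl rfl))

theorem cG_eq : cG = inW (Multiplicative.ofAdd 3) :=
  toG_eq_of_mem (Or.inr (Or.inr rfl))

theorem cG_mul_cG : cG * cG = 1 := by
  rw [cG, ← map_mul, Equiv.swap_mul_self, map_one]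

theorem X_mul_cG_pow : inU Pauli.X.toU * cG * inU Pauli.X.toU =
    cG * inU Pauli.X.toU * cG := by
  rw [inU_X, cG, ← map_mul, ← map_mul, ← map_mul, ← map_mul]
  congr 1
  decide

/-! ### The action of the direct limit on normal forms -/

theorem perm_three_cases (v : Equiv.Perm (Fin 3)) :
    v = 1 ∨ v = Equiv.swap 0 1 ∨ v = Equiv.swap 1 2 ∨ v = Equiv.swap 0 1 * Equiv.swap 1 2 ∨
      v = Equiv.swap 1 2 * Equiv.swap 0 1 ∨
      v = Equiv.swap 0 1 * (Equiv.swap 1 2 * Equiv.swap 0 1) := by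
  revert v
  decide

/-- The symmetric group on three letters is generated by two involutions with product of order
three as only relations. -/
theorem exists_perm_three_hom {H : Type} [Group H] {a b : H} (ha : a * a = 1) (hb : b * b = 1)
    (hab : a * b * a = b * a * b) :
    ∃ f : Equiv.Perm (Fin 3) →* H, f (Equiv.swap 0 1) = a ∧ f (Equiv.swap 1 2) = b := by
  let F : Equiv.Perm (Fin 3) → H := fun v =>
    if v = 1 then 1 else if v = Equiv.swap 0 1 then a else if v = Equiv.swap 1 2 then b
    else if v = Equiv.swap 0 1 * Equiv.swap 1 2 then a * b
    else if v = Equiv.swap 1 2 * Equiv.swap 0 1 then b * a else a * (b * a)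
  have f1 : F 1 = 1 := rfl
  have f2 : F (Equiv.swap 0 1) = a := rfl
  have f3 : F (Equiv.swap 1 2) = b := rfl
  have f4 : F (Equiv.swap 0 1 * Equiv.swap 1 2) = a * b := rfl
  have f5 : F (Equiv.swap 1 2 * Equiv.swap 0 1) = b * a := rfl
  have f6 : F (Equiv.swap 0 1 * (Equiv.swap 1 2 * Equiv.swap 0 1)) = a * (b * a) := rfl
  have haa : ∀ x, a * (a * x) = x := fun x => by rw [← mul_assoc, ha, one_mul]
  have hbb : ∀ x, b * (b * x) = x := fun x => by rw [← mul_assoc, hb, one_mul]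
  have hba : b * (a * b) = a * (b * a) := by rw [← mul_assoc, ← mul_assoc, hab]
  have hs : ∀ v, F (Equiv.swap 0 1 * v) = a * F v := by
    intro v
    rcases perm_three_cases v with rfl | rfl | rfl | rfl | rfl | rfl
    · rw [mul_one, f1, f2, mul_one]
    · rw [Equiv.swap_mul_self, f1, f2, ha]
    · rw [f3, f4]
    · rw [Equiv.swap_mul_self_mul, f4, f3, haa]
    · rw [f6, f5]
    · rw [Equiv.swap_mul_self_mul, f6, f5, haa]
  have hr : ∀ v, F (Equiv.swap 1 2 * v) = b * F v := by
    intro v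
    rcases perm_three_cases v with rfl | rfl | rfl | rfl | rfl | rfl
    · rw [mul_one, f1, f3, mul_one]
    · rw [f5, f2]
    · rw [Equiv.swap_mul_self, f1, f3, hb]
    · rw [f4, hba, ← f6]
      exact congrArg F (by decide)
    · rw [Equiv.swap_mul_self_mul, f5, f2, hbb]
    · rw [f6, ← hba, hbb, ← f4]
      exact congrArg F (by decide)
  refine ⟨MonoidHom.mk' F ?_, f2, f3⟩
  intro v w
  rcases perm_three_cases v with rfl | rfl | rfl | rfl | rfl | rfl
  · rw [one_mul, f1, one_mul]
  · rw [hs, f2]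
  · rw [hr, f3]
  · rw [mul_assoc, hs, hr, f4, mul_assoc]
  · rw [mul_assoc, hr, hs, f5, mul_assoc]
  · rw [mul_assoc, mul_assoc, hs, hr, hs, f6, mul_assoc, mul_assoc]

/-- The set of normal forms on which `G` acts. -/
abbrev Form : Type := {x : Node P // pauliSystem.Valid x} × U

/-- The action of `U` on the normal forms. -/
noncomputable def actU : U →* Equiv.Perm Form where
  toFun u := (Equiv.refl _).prodCongr (Equiv.mulRight u⁻¹)
  map_one' := by ext1 e; simp
  map_mul' u u' := Equiv.ext fun e => Prod.ext rfl (by simp [mul_assoc])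

theorem actU_apply (u : U) (x : {x : Node P // pauliSystem.Valid x}) (w : U) :
    actU u (x, w) = (x, w * u⁻¹) := rfl

/-- The normal form with a given edge and position about the edge. -/
def Form.mk (k : Multiplicative (ZMod 3)) (e : pauliSystem.Edge) : Form := (e.1, ⟨e.2, k⟩)

/-- The action of the generator of `C` on the normal forms. -/
noncomputable def actC : Equiv.Perm Form :=
  Function.Involutive.toPerm
    (fun e => Form.mk e.2.right (pauliSystem.flipEquiv (e.1, e.2.left)))
    (fun e => by
      change Form.mk e.2.right (pauliSystem.flipEquiv (pauliSystem.flipEquiv (e.1, e.2.left))) = e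
      rw [← Equiv.Perm.mul_apply, LetterSystem.flipEquiv_mul_self]
      rfl)

theorem actC_mk (k : Multiplicative (ZMod 3)) (e : pauliSystem.Edge) :
    actC (Form.mk k e) = Form.mk k (pauliSystem.flipEquiv e) := rfl

theorem actC_mul_self : actC * actC = 1 := Equiv.ext fun e => actC.left_inv e

theorem exists_act_toP (k : Multiplicative (ZMod 3)) (M : Pauli) :
    ∃ N : Pauli, act k M.toP = N.toP := by
  have hsymm : ∀ M : Pauli, ∃ N : Pauli, cycle⁻¹ M.toP = N.toP := by
    intro M
    obtain ⟨N, rfl⟩ : ∃ N : Pauli, N.next = M := by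
      cases M
      exacts [⟨.Z, rfl⟩, ⟨.X, rfl⟩, ⟨.Y, rfl⟩]
    exact ⟨N, by rw [← cycle_toP, MulAut.inv_apply_self]⟩
  have : ∀ (n : ℕ) (M : Pauli), ∃ N : Pauli, ((cycle ^ n)⁻¹ : MulAut P) M.toP = N.toP := by
    intro n
    induction n with
    | zero => exact fun M => ⟨M, by simp⟩
    | succ n ih =>
      intro M
      obtain ⟨N, hN⟩ := hsymm M
      obtain ⟨K, hK⟩ := ih N
      refine ⟨K, ?_⟩
      rw [pow_succ', mul_inv_rev, MulAut.mul_apply, hN, hK]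
  exact this _ M

theorem toU_inv (M : Pauli) : M.toU⁻¹ = M.toU := by
  rw [inv_eq_iff_mul_eq_one, Pauli.toU, ← map_mul, toP_mul_self, map_one]

/-- On the layer `k` of the normal forms, right multiplication by `X` passes through the factor
`ℤ/3` and becomes a turn by a Pauli letter that depends on `k`. -/
theorem actU_X_mk (k : Multiplicative (ZMod 3)) {N : Pauli}
    (hN : act k Pauli.X.toP = N.toP) (e : pauliSystem.Edge) :
    actU Pauli.X.toU (Form.mk k e) = Form.mk k (pauliSystem.turnEquiv N e) := by
  change (e.1, (⟨e.2, k⟩ : U) * Pauli.X.toU⁻¹) = (e.1, (⟨e.2 * N.toP, k⟩ : U))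
  rw [toU_inv, ← hN]
  congr 1
  apply SemidirectProduct.ext <;> simp [Pauli.toU]

/-- Both factors preserve the layers, and on each layer this is the closing of triangles for a
single letter. -/
theorem actU_X_actC : (actU Pauli.X.toU * actC) ^ 3 = 1 := by
  ext1 e
  obtain ⟨k, e, rfl⟩ : ∃ k e', e = Form.mk k e' := ⟨e.2.right, (e.1, e.2.left), rfl⟩
  obtain ⟨N, hN⟩ := exists_act_toP k Pauli.X
  have h : ∀ e, (actU Pauli.X.toU * actC) (Form.mk k e) =
      Form.mk k ((pauliSystem.turnEquiv N * pauliSystem.flipEquiv) e) := fun e => by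
    rw [Equiv.Perm.mul_apply, actC_mk, actU_X_mk k hN, Equiv.Perm.mul_apply]
  have h2 := congrArg (fun f => f e) (LetterSystem.turn_mul_flip_pow_three (S := pauliSystem) N)
  rw [pow_three] at h2 ⊢
  change (actU Pauli.X.toU * actC) ((actU Pauli.X.toU * actC)
    ((actU Pauli.X.toU * actC) (Form.mk k e))) = _
  rw [h, h, h]
  exact congrArg (Form.mk k) h2

theorem actC_mul_T : actC * actU T = actU T * actC := by
  ext1 e
  obtain ⟨x, ⟨p, k⟩⟩ := e
  have h : ∀ (p : P) (k : Multiplicative (ZMod 3)),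
      (⟨p, k⟩ : U) * T⁻¹ = ⟨p, k * (Multiplicative.ofAdd 1)⁻¹⟩ := by
    intro p k
    apply SemidirectProduct.ext <;> simp [T]
  rw [Equiv.Perm.mul_apply, Equiv.Perm.mul_apply, actU_apply, h]
  change _ = actU T (Form.mk k (pauliSystem.flipEquiv (x, p)))
  rw [Form.mk, actU_apply, h]
  rfl

theorem T_pow_three : T ^ 3 = 1 := by
  rw [T, ← map_pow, ← map_one (SemidirectProduct.inr (φ := act))]
  congr 1

/-- The relations of the three vertex groups and the identifications are all that has to be checked.
`V` is handled by its Coxeter presentation, whose braid relation is the closing of triangles. -/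
theorem exists_action : ∃ ρ : G →* Equiv.Perm Form, (∀ u, ρ (inU u) = actU u) ∧ ρ cG = actC := by
  have hX : actU Pauli.X.toU * actU Pauli.X.toU = 1 := by
    rw [← map_mul, ← map_one actU]
    congr 1
    rw [← inv_eq_iff_mul_eq_one, toU_inv]
  have hXC : actU Pauli.X.toU * actC * actU Pauli.X.toU = actC * actU Pauli.X.toU * actC := by
    have h := actU_X_actC
    have hXi := inv_eq_of_mul_eq_one_left hX
    have hCi := inv_eq_of_mul_eq_one_left actC_mul_self
    rw [pow_three', mul_eq_one_iff_eq_inv, mul_inv_rev, hXi, hCi] at h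
    rw [← h, ← mul_assoc, mul_assoc _ actC actC, actC_mul_self, mul_one]
  obtain ⟨ρV, hV1, hV2⟩ := exists_perm_three_hom hX actC_mul_self hXC
  have hT3 : actU T ^ 3 = 1 := by rw [← map_pow, T_pow_three, map_one]
  have hcomm : Commute actC (actU T) := actC_mul_T
  -- The generator of `W` acts as `c T²`: its square is `T^4 = T` and its cube is `c T^6 = c`.
  have hz6 : (actC * (actU T) ^ 2) ^ 6 = 1 := by
    rw [(hcomm.pow_right 2).mul_pow, ← pow_mul, show 2 * 6 = 3 * 4 from rfl, pow_mul, hT3,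
      show 6 = 2 * 3 from rfl, pow_mul, pow_two, actC_mul_self, one_pow, one_pow, one_mul]
  let ρW : W →* Equiv.Perm Form :=
    MonoidHom.mk' (fun k => (actC * (actU T) ^ 2) ^ (Multiplicative.toAdd k).val) (by
      intro a b
      rw [← pow_add, toAdd_mul, ZMod.val_add, ← pow_eq_pow_mod _ hz6])
  have hW2 : ρW (Multiplicative.ofAdd 2) = actU T := by
    change (actC * (actU T) ^ 2) ^ 2 = actU T
    rw [(hcomm.pow_right 2).mul_pow, pow_two actC, actC_mul_self, one_mul, ← pow_mul,
      show 2 * 2 = 3 + 1 from rfl, pow_succ, hT3, one_mul]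
  have hW3 : ρW (Multiplicative.ofAdd 3) = actC := by
    change (actC * (actU T) ^ 2) ^ 3 = actC
    rw [(hcomm.pow_right 2).mul_pow, pow_three', actC_mul_self, one_mul, ← pow_mul,
      mul_comm 2 3, pow_mul, hT3, one_pow, mul_one]
  let ρ₀ : FreeProd →* Equiv.Perm Form :=
    Monoid.Coprod.lift actU (Monoid.Coprod.lift ρV ρW)
  have hmem : ∀ x y, ρ₀ x = ρ₀ y → ρ₀ (x * y⁻¹) = 1 := by
    intro x y h
    rw [map_mul, h, ← map_mul]
    exact (congrArg ρ₀ (mul_inv_cancel y)).trans (map_one ρ₀)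
  have hker : ∀ x ∈ Subgroup.normalClosure identifications, ρ₀ x = 1 := by
    intro x hx
    have hle : Subgroup.normalClosure identifications ≤ ρ₀.ker := by
      apply Subgroup.normalClosure_le_normal
      rintro y (rfl | rfl | rfl)
      all_goals change ρ₀ _ = 1
      · exact hmem _ _ (by simp [ρ₀, freeU, freeW, hW2])
      · exact hmem _ _ (by simp [ρ₀, freeU, freeV, hV1])
      · exact hmem _ _ (by simp [ρ₀, freeW, freeV, hV2, hW3])
    exact hle hx
  refine ⟨QuotientGroup.lift _ ρ₀ hker, fun u => ?_, ?_⟩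
  · change ρ₀ (freeU u) = _
    simp [ρ₀, freeU]
  · change ρ₀ (freeV _) = _
    simp [ρ₀, freeV, hV2]

/-- The action of `G` on the normal forms. -/
noncomputable def rho : G →* Equiv.Perm Form := exists_action.choose

theorem rho_inU (u : U) : rho (inU u) = actU u := exists_action.choose_spec.1 u

theorem rho_cG : rho cG = actC := exists_action.choose_spec.2

/-- The base point of the set of normal forms. -/
noncomputable def baseForm : Form := (⟨.root, trivial⟩, 1)

/-! ### The local groups embed and intersect in the edge groups -/

theorem inU_injective : Function.Injective inU := by
  rw [injective_iff_map_eq_one]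
  intro u hu
  have h : rho (inU u) baseForm = baseForm := by rw [hu, map_one]; rfl
  rw [rho_inU, baseForm, actU_apply] at h
  have := (Prod.mk.inj h).2
  simpa using this

theorem rho_cG_baseForm : (rho cG baseForm).1.1 = .a .root 1 := by
  rw [rho_cG]
  change (pauliSystem.flip .root 1).1 = _
  rw [LetterSystem.flip_tail (x := .root) (map_one _)]

/-- `U` fixes the vertex of a normal form, whereas `c` moves the base form off the root. -/
theorem cG_ne_inU (u : U) : cG ≠ inU u := by
  intro h
  have h1 := rho_cG_baseForm
  rw [h, rho_inU] at h1
  change Node.root = _ at h1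
  cases h1

/-- An element of `V` other than 1 and `(1, 2)` is `c` up to factors `X` on either side, so its
membership in `U` would put `c` in `U`. -/
theorem inU_eq_inV {u : U} {v : V} (h : inU u = inV v) : u = 1 ∨ u = Pauli.X.toU := by
  rcases perm_three_cases v with rfl | rfl | rfl | rfl | rfl | rfl
  · left; exact inU_injective (by rw [h, map_one, map_one])
  · right; exact inU_injective (by rw [h, inU_X])
  · exact (cG_ne_inU _ h.symm).elim
  · rw [map_mul, ← inU_X, ← inv_mul_eq_iff_eq_mul, ← map_inv, ← map_mul] at h
    exact (cG_ne_inU _ h.symm).elim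
  · rw [map_mul, ← inU_X, ← mul_inv_eq_iff_eq_mul, ← map_inv, ← map_mul] at h
    exact (cG_ne_inU _ h.symm).elim
  · rw [map_mul, map_mul, ← inU_X, ← inv_mul_eq_iff_eq_mul, ← mul_inv_eq_iff_eq_mul, ← map_inv,
      ← map_mul, ← map_mul] at h
    exact (cG_ne_inU _ h.symm).elim

theorem inU_inr (k : Multiplicative (ZMod 3)) :
    inU (SemidirectProduct.inr k) =
      inW (Multiplicative.ofAdd (2 * ((Multiplicative.toAdd k).val : ZMod 6))) := by
  have h : (SemidirectProduct.inr k : U) = T ^ (Multiplicative.toAdd k).val := by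
    rw [T, ← map_pow]
    congr 1
    revert k
    decide
  rw [h, map_pow, inU_T, ← map_pow]
  congr 1
  clear h
  revert k
  decide

theorem inW_cases (w : W) : ∃ k : Multiplicative (ZMod 3),
    inW w = inU (SemidirectProduct.inr k) ∨ inW w = inU (SemidirectProduct.inr k) * cG := by
  have h : ∀ w : W, ∃ k : Multiplicative (ZMod 3),
      w = Multiplicative.ofAdd (2 * ((Multiplicative.toAdd k).val : ZMod 6)) ∨
      w = Multiplicative.ofAdd (2 * ((Multiplicative.toAdd k).val : ZMod 6)) *
        Multiplicative.ofAdd 3 := by decide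
  obtain ⟨k, h | h⟩ := h w
  · exact ⟨k, Or.inl (by rw [inU_inr, ← h])⟩
  · exact ⟨k, Or.inr (by rw [inU_inr, cG_eq, ← map_mul, ← h])⟩

theorem inU_eq_inW {u : U} {w : W} (h : inU u = inW w) : ∃ k, u = SemidirectProduct.inr k := by
  obtain ⟨k, hk | hk⟩ := inW_cases w
  · exact ⟨k, inU_injective (h.trans hk)⟩
  · rw [hk, ← inv_mul_eq_iff_eq_mul, ← map_inv, ← map_mul] at h
    exact (cG_ne_inU _ h.symm).elim

theorem tau_inU (u : U) : tau (inU u) = u.right := by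
  change freeTau (freeU u) = _
  simp [freeTau, freeU]

theorem tau_inV (v : V) : tau (inV v) = 1 := by
  change freeTau (freeV v) = _
  simp [freeTau, freeV]

theorem tau_cG : tau cG = 1 := tau_inV _

/-- Elements of `W` are `T^k` or `T^k c`; triviality of `τ` on `V` forces `T^k = 1`. -/
theorem inV_eq_inW {v : V} {w : W} (h : inV v = inW w) : inV v = 1 ∨ inV v = cG := by
  have ht := tau_inV v
  rw [h] at ht ⊢
  obtain ⟨k, hk | hk⟩ := inW_cases w
  · left
    rw [hk, tau_inU] at ht
    rw [hk, show k = 1 from ht, map_one, map_one]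
  · right
    rw [hk, map_mul, tau_inU, tau_cG, mul_one] at ht
    rw [hk, show k = 1 from ht, map_one, map_one, one_mul]


/-! ### Flats in the development -/

/-- A marked flat in the development: an element of `G` for every oriented edge of the tiled
plane, compatible with the rotations by Pauli matrices about vertices and with the reversal of
edges. The oriented edge that starts from `v` in the direction `dir i` has number `i` at `v`. -/
structure Flat where
  edge : ℤ × ℤ → Fin 6 → G
  label : ℤ × ℤ → Fin 6 → Pauli
  turn : ∀ v i, edge v (i + 1) = edge v i * inU (label v i).toU
  reverse : ∀ v i, edge (v + dir i) (i + 3) = edge v i * cG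
  label_ne : ∀ v i, label v i ≠ label v (i + 1)

/-- The normal form of the element `x⁻¹ g`. -/
noncomputable def form (x g : G) : Form := rho (x⁻¹ * g)⁻¹ baseForm

theorem form_mul (x g h : G) : form x (g * h) = rho h⁻¹ (form x g) := by
  rw [form, ← mul_assoc, mul_inv_rev, map_mul]
  rfl

theorem form_mul_inU (x g : G) (u : U) : form x (g * inU u) = ((form x g).1, (form x g).2 * u) := by
  rw [form_mul, ← map_inv, rho_inU]
  generalize form x g = e
  obtain ⟨y, w⟩ := e
  rw [actU_apply, inv_inv]

theorem form_mul_cG (x g : G) : form x (g * cG) = actC (form x g) := by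
  rw [form_mul, inv_eq_of_mul_eq_one_left cG_mul_cG, rho_cG]

/-- The normal form of `x⁻¹ g` has trivial component in `ℤ/3` and satisfies the condition `R`. -/
def FormAt (x : G) (R : Node P → P → Prop) (g : G) : Prop :=
  ∃ e : pauliSystem.Edge, form x g = Form.mk 1 e ∧ R e.1.1 e.2

theorem FormAt.mul_letter {x g : G} {R R' : Node P → P → Prop} (h : FormAt x R g) (M : Pauli)
    (hR : ∀ y p, R y p → R' y (p * M.toP)) : FormAt x R' (g * inU M.toU) := by
  obtain ⟨e, he, hRe⟩ := h
  refine ⟨(e.1, e.2 * M.toP), ?_, hR _ _ hRe⟩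
  rw [form_mul_inU, he]
  refine Prod.ext rfl (SemidirectProduct.ext ?_ ?_) <;> simp [Form.mk, Pauli.toU]

theorem FormAt.mul_three_letters {x g : G} {R R' : Node P → P → Prop} (h : FormAt x R g)
    (N K M : Pauli) (hR : ∀ y p, R y p → R' y (p * N.toP * K.toP * M.toP)) :
    FormAt x R' (g * inU N.toU * inU K.toU * inU M.toU) :=
  ((h.mul_letter N (R' := fun y p => R y (p * N.toP⁻¹)) (fun y p hp => by
    rwa [mul_inv_cancel_right])).mul_letter K
    (R' := fun y p => R y (p * K.toP⁻¹ * N.toP⁻¹)) (fun y p hp => by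
    rwa [mul_inv_cancel_right])).mul_letter M (fun y p hp => by
    have := hR _ _ hp
    rwa [inv_mul_cancel_right, inv_mul_cancel_right] at this)

theorem FormAt.mul_cG {x g : G} {R R' : Node P → P → Prop} (h : FormAt x R g)
    (hR : ∀ y p, pauliSystem.Valid y → R y p →
      R' (pauliSystem.flip y p).1 (pauliSystem.flip y p).2) : FormAt x R' (g * cG) := by
  obtain ⟨e, he, hRe⟩ := h
  exact ⟨pauliSystem.flipEquiv e, by rw [form_mul_cG, he, actC_mk], hR _ _ e.1.2 hRe⟩

theorem FormAt.mono {x g : G} {R R' : Node P → P → Prop} (h : FormAt x R g)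
    (hR : ∀ y p, R y p → R' y p) : FormAt x R' g := by
  obtain ⟨e, he, hRe⟩ := h
  exact ⟨e, he, hR _ _ hRe⟩

/-- The coset of `U` at the base point corresponds to the root, which has no downward edges. This is
how a downward edge separates cosets. -/
theorem not_formAt_downIn (x : G) (u : U) : ¬ FormAt x pauliSystem.DownIn (x * inU u) := by
  rintro ⟨e, he, hR⟩
  rw [form_mul_inU] at he
  have h1 : form x x = baseForm := by rw [form, inv_mul_cancel, inv_one, map_one]; rfl
  rw [h1] at he
  have h2 : e.1 = baseForm.1 := (Prod.mk.inj he).1.symm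
  rw [h2] at hR
  exact hR

theorem sgn_mul_toP (p : P) (M : Pauli) :
    pauliSystem.sgn (p * M.toP) = -pauliSystem.sgn p :=
  LetterSystem.sgn_mul_letter p M

/-- The negative edges towards the root at vertices which have only one edge towards the root. -/
def IsStem (y : Node P) (p : P) : Prop := p = 1 ∧ ∃ z r, y = .a z r

theorem IsStem.downIn {y : Node P} {p : P} (h : IsStem y p) : pauliSystem.DownIn y p := by
  obtain ⟨h, z, r, rfl⟩ := h
  exact h

theorem IsStem.upOut {y : Node P} {p : P} (h : IsStem y p) (M : Pauli) :
    pauliSystem.UpOut y (p * M.toP) := by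
  obtain ⟨rfl, z, r, rfl⟩ := h
  rw [one_mul]
  exact pauliSystem.sgn_letter M

theorem IsStem.tail {y : Node P} {p : P} (h : IsStem y p) {N K M : Pauli} (hNK : N ≠ K)
    (hKM : K ≠ M) : pauliSystem.Tail y (p * N.toP * K.toP * M.toP) := by
  obtain ⟨rfl, z, r, rfl⟩ := h
  rw [one_mul]
  refine ⟨?_, LetterSystem.not_isLetter_three hNK hKM⟩
  change pauliSystem.sgn (pauliSystem.letter N * pauliSystem.letter K * pauliSystem.letter M) = _
  rw [LetterSystem.sgn_mul_letter, LetterSystem.sgn_pair]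

/-- Going straight on in a flat means a path of three letters in the link. Starting from a downward
letter `J`, the result 1 would make three reduced letters equal to `J`, a 4-cycle. -/
theorem downIn_upOut {y : Node P} {p : P} (h : pauliSystem.DownIn y p) {N K M : Pauli}
    (hNK : N ≠ K) (hKM : K ≠ M) : pauliSystem.UpOut y (p * N.toP * K.toP * M.toP) := by
  cases y with
  | root => exact h.elim
  | a z r => exact (IsStem.tail ⟨h, z, r, rfl⟩ hNK hKM).upOut
  | b z r =>
    obtain ⟨J, rfl⟩ := h
    change pauliSystem.sgn (pauliSystem.letter J * pauliSystem.letter N * pauliSystem.letter K *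
      pauliSystem.letter M) = 1 ∧ (pauliSystem.letter J * pauliSystem.letter N *
      pauliSystem.letter K * pauliSystem.letter M) ≠ 1
    constructor
    · rw [LetterSystem.sgn_mul_letter, LetterSystem.sgn_mul_letter, LetterSystem.sgn_pair, neg_neg]
    · intro h1
      apply LetterSystem.not_isLetter_three (S := pauliSystem) hNK hKM
      refine ⟨J, ?_⟩
      rw [mul_assoc, mul_assoc, mul_eq_one_iff_inv_eq,
        inv_eq_of_mul_eq_one_left (pauliSystem.mul_self J), ← mul_assoc] at h1
      exact h1

/-! ### Paths in a flat lead away from the root -/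

namespace Flat

variable (F : Flat)

theorem turn_symm (v : ℤ × ℤ) (i : Fin 6) :
    F.edge v i = F.edge v (i + 1) * inU (F.label v i).toU := by
  rw [F.turn, mul_assoc, ← map_mul, inv_eq_iff_mul_eq_one.1 (toU_inv _), map_one, mul_one]

theorem straight (v : ℤ × ℤ) (i : Fin 6) :
    F.edge (v + dir i) i = F.edge v i * cG * inU (F.label (v + dir i) (i + 3)).toU *
      inU (F.label (v + dir i) (i + 3 + 1)).toU *
      inU (F.label (v + dir i) (i + 3 + 1 + 1)).toU := by
  rw [← F.reverse, ← F.turn, ← F.turn, ← F.turn]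
  congr 1
  revert i
  decide

/-- Each turn changes the sign, so the directions 0, 2, 4 are the positive edges at the base vertex.
-/
theorem formAt_even (v : ℤ × ℤ) {i : Fin 6} (hi : i = 0 ∨ i = 2 ∨ i = 4) :
    FormAt (F.edge v 0) (fun y p => y = .root ∧ pauliSystem.sgn p = 1) (F.edge v i) := by
  have h0 : FormAt (F.edge v 0) (fun y p => y = .root ∧ pauliSystem.sgn p = 1) (F.edge v 0) := by
    refine ⟨(⟨.root, trivial⟩, 1), ?_, rfl, map_one _⟩
    rw [form, inv_mul_cancel, inv_one, map_one]
    rfl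
  have h2 : ∀ i, FormAt (F.edge v 0) (fun y p => y = .root ∧ pauliSystem.sgn p = 1) (F.edge v i) →
      FormAt (F.edge v 0) (fun y p => y = .root ∧ pauliSystem.sgn p = 1)
        (F.edge v (i + 1 + 1)) := by
    intro i hi
    rw [F.turn, F.turn]
    refine (hi.mul_letter _ (R' := fun y p => y = .root ∧ pauliSystem.sgn p = -1) ?_).mul_letter
      _ ?_
    · rintro y p ⟨rfl, hp⟩
      exact ⟨rfl, by rw [sgn_mul_toP, hp]⟩
    · rintro y p ⟨rfl, hp⟩
      exact ⟨rfl, by rw [sgn_mul_toP, hp, neg_neg]⟩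
  rcases hi with rfl | rfl | rfl
  · exact h0
  · rw [show (2 : Fin 6) = 0 + 1 + 1 from rfl]
    exact h2 _ h0
  · rw [show (4 : Fin 6) = 0 + 1 + 1 + 1 + 1 from rfl]
    exact h2 _ (h2 _ h0)

/-- Along a straight ray each vertex is entered by its only downward edge, the edge 1 of an `a`
vertex. Three reduced letters are never a letter, so the continuation is again a tail. -/
theorem formAt_tail (v : ℤ × ℤ) {i : Fin 6} (hi : i = 0 ∨ i = 2 ∨ i = 4) (n : ℕ) :
    FormAt (F.edge v 0) pauliSystem.Tail (F.edge (v + n • dir i) i) := by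
  induction n with
  | zero =>
    rw [zero_smul, add_zero]
    exact (F.formAt_even v hi).mono (by rintro y p ⟨rfl, hp⟩; exact hp)
  | succ n ih =>
    rw [succ_nsmul, ← add_assoc, F.straight]
    have h := ih.mul_cG (R' := IsStem) (by
      intro y p _ hp
      rw [LetterSystem.flip_tail hp]
      exact ⟨rfl, _, _, rfl⟩)
    have hne := F.label_ne (v + n • dir i + dir i)
    exact h.mul_three_letters _ _ _ fun y p hp => hp.tail (hne (i + 3)) (hne (i + 3 + 1))

theorem formAt_stem (v : ℤ × ℤ) {i : Fin 6} (hi : i = 0 ∨ i = 2 ∨ i = 4) (n : ℕ) :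
    FormAt (F.edge v 0) IsStem (F.edge (v + (n + 1) • dir i) (i + 3)) := by
  rw [succ_nsmul, ← add_assoc, F.reverse]
  refine (F.formAt_tail v hi n).mul_cG ?_
  intro y p _ hp
  rw [LetterSystem.flip_tail hp]
  exact ⟨rfl, _, _, rfl⟩

/-- After the bend the path still climbs, but possibly no longer along tails; it is enough that it
enters each vertex by a `DownIn` edge. -/
theorem formAt_upOut (v : ℤ × ℤ) {i : Fin 6} (hi : i = 0 ∨ i = 2 ∨ i = 4) (n m : ℕ) :
    FormAt (F.edge v 0) pauliSystem.UpOut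
      (F.edge (v + n • dir i + m • dir (i + 2)) (i + 2)) := by
  induction m with
  | zero =>
    rw [zero_smul, add_zero]
    cases n with
    | zero =>
      rw [zero_smul, add_zero]
      have hi2 : i + 2 = 0 ∨ i + 2 = 2 ∨ i + 2 = 4 := by revert i; decide
      exact (F.formAt_even v hi2).mono (by rintro y p ⟨rfl, hp⟩; exact hp)
    | succ n =>
      -- The new direction is one letter away from the stem, which points backwards in direction `i
      -- + 3`.
      rw [F.turn_symm _ (i + 2), show i + 2 + 1 = i + 3 by revert i; decide]
      exact (F.formAt_stem v hi n).mul_letter _ fun y p hp => hp.upOut _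
  | succ m ih =>
    rw [succ_nsmul, ← add_assoc, F.straight]
    have h := ih.mul_cG (R' := pauliSystem.DownIn) (fun y p hy hp =>
      (LetterSystem.flip_upOut y hy p hp).2.1)
    have hne := F.label_ne (v + n • dir i + m • dir (i + 2) + dir (i + 2))
    exact h.mul_three_letters _ _ _ fun y p hp =>
      downIn_upOut hp (hne (i + 2 + 3)) (hne (i + 2 + 3 + 1))

theorem formAt_downIn (v : ℤ × ℤ) {i : Fin 6} (hi : i = 0 ∨ i = 2 ∨ i = 4) (n m : ℕ)
    (hnm : n ≠ 0 ∨ m ≠ 0) : ∃ j, FormAt (F.edge v 0) pauliSystem.DownIn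
      (F.edge (v + n • dir i + m • dir (i + 2)) j) := by
  cases m with
  | zero =>
    obtain ⟨n, rfl⟩ := Nat.exists_eq_succ_of_ne_zero (hnm.resolve_right (not_not.2 rfl))
    rw [zero_smul, add_zero]
    exact ⟨i + 3, (F.formAt_stem v hi n).mono fun y p h => h.downIn⟩
  | succ m =>
    refine ⟨i + 2 + 3, ?_⟩
    rw [succ_nsmul, ← add_assoc, F.reverse]
    exact (F.formAt_upOut v hi n m).mul_cG fun y p hy hp =>
      (LetterSystem.flip_upOut y hy p hp).2.1

/-- The positive directions 0, 2, 4 cut the plane into three sectors of angle `2π/3`; the three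
pairs of inequalities describe them in lattice coordinates. -/
theorem exists_sector (v w : ℤ × ℤ) : ∃ i : Fin 6, (i = 0 ∨ i = 2 ∨ i = 4) ∧
    ∃ n m : ℕ, w = v + n • dir i + m • dir (i + 2) := by
  obtain ⟨a, b⟩ := v
  obtain ⟨c, d⟩ := w
  have h : (0 ≤ d - b ∧ 0 ≤ (c - a) + (d - b)) ∨ (c - a ≤ 0 ∧ (c - a) + (d - b) ≤ 0) ∨
      (0 ≤ c - a ∧ d - b ≤ 0) := by omega
  rcases h with ⟨h1, h2⟩ | ⟨h1, h2⟩ | ⟨h1, h2⟩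
  · refine ⟨0, Or.inl rfl, ((c - a) + (d - b)).toNat, (d - b).toNat, ?_⟩
    ext <;> simp [dir] <;> omega
  · refine ⟨2, Or.inr (Or.inl rfl), (-(c - a)).toNat, (-((c - a) + (d - b))).toNat, ?_⟩
    rw [show (2 : Fin 6) + 2 = 4 from rfl]
    ext <;> simp [dir] <;> omega
  · refine ⟨4, Or.inr (Or.inr rfl), (-(d - b)).toNat, (c - a).toNat, ?_⟩
    rw [show (4 : Fin 6) + 2 = 0 from rfl]
    ext <;> simp [dir] <;> omega

theorem exists_edge_eq (v : ℤ × ℤ) (i j : Fin 6) : ∃ u, F.edge v j = F.edge v i * inU u := by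
  have h : ∀ i : Fin 6, ∃ u, F.edge v i = F.edge v 0 * inU u := by
    intro i
    induction i using Fin.induction with
    | zero => exact ⟨1, by simp⟩
    | succ i ih =>
      obtain ⟨u, hu⟩ := ih
      refine ⟨u * (F.label v i.castSucc).toU, ?_⟩
      rw [← Fin.coeSucc_eq_succ, F.turn, hu, map_mul, mul_assoc]
  obtain ⟨u, hu⟩ := h i
  obtain ⟨u', hu'⟩ := h j
  exact ⟨u⁻¹ * u', by rw [hu, hu', map_mul, map_inv]; group⟩

/-- Different vertices of a flat are in different cosets of `U`. -/
theorem eq_of_edge_eq {v w : ℤ × ℤ} {i j : Fin 6} {u : U}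
    (h : F.edge w j = F.edge v i * inU u) : v = w := by
  obtain ⟨k, hk, n, m, rfl⟩ := exists_sector v w
  by_cases hnm : n ≠ 0 ∨ m ≠ 0
  · exfalso
    obtain ⟨l, hl⟩ := F.formAt_downIn v hk n m hnm
    obtain ⟨u1, h1⟩ := F.exists_edge_eq (v + n • dir k + m • dir (k + 2)) j l
    obtain ⟨u2, h2⟩ := F.exists_edge_eq v 0 i
    rw [h1, h, h2, mul_assoc, mul_assoc, ← map_mul, ← map_mul] at hl
    exact not_formAt_downIn _ _ hl
  · push Not at hnm
    rw [hnm.1, hnm.2]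
    simp

end Flat


/-! ### The barycentric subdivision of the tiled plane -/

/-- The simplices of the tiled plane, which are the vertices of its barycentric subdivision. -/
abbrev ESimplex : Type := {s : Finset (ℤ × ℤ) // s ∈ E.faces}

/-- The vertex `v` as a simplex. -/
def vb (v : ℤ × ℤ) : ESimplex := ⟨{v}, E.singleton_mem v⟩

/-- The face number `i` around `v` as a simplex. -/
def fb (v : ℤ × ℤ) (i : Fin 6) : ESimplex := ⟨(around v i).1, (around v i).2.1⟩

theorem fb_val (v : ℤ × ℤ) (i : Fin 6) : (fb v i).1 = {v, v + dir i, v + dir (i + 1)} := rfl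

/-- The edge from `v` in the direction `dir i` as a simplex. -/
def eb (v : ℤ × ℤ) (i : Fin 6) : ESimplex :=
  ⟨{v, v + dir i}, (E.isRelLowerSet_faces (fb v i).2).2
    (by rw [fb_val]; intro x; simp only [Finset.mem_insert, Finset.mem_singleton]; tauto)
    ⟨v, by simp⟩⟩

theorem eb_val (v : ℤ × ℤ) (i : Fin 6) : (eb v i).1 = {v, v + dir i} := rfl

theorem dir_ne_zero (i : Fin 6) : dir i ≠ 0 := by revert i; decide

theorem dir_injective : Function.Injective dir := by
  have : ∀ i j, dir i = dir j → i = j := by decide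
  exact this

theorem dir_add_three (i : Fin 6) : dir i + dir (i + 3) = 0 := by revert i; decide

theorem dir_add_two (i : Fin 6) : dir i + dir (i + 2) = dir (i + 1) := by revert i; decide

theorem fin_six_ne_add_one (i : Fin 6) : i ≠ i + 1 := by revert i; decide

theorem ne_add_dir (v : ℤ × ℤ) (i : Fin 6) : v ≠ v + dir i := fun h =>
  dir_ne_zero i (left_eq_add.1 h)

theorem add_dir_inj {v : ℤ × ℤ} {i j : Fin 6} (h : v + dir i = v + dir j) : i = j :=
  dir_injective (add_left_cancel h)

theorem eb_add_dir (v : ℤ × ℤ) (i : Fin 6) : eb (v + dir i) (i + 3) = eb v i := by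
  apply Subtype.ext
  rw [eb_val, eb_val, add_assoc, dir_add_three, add_zero, Finset.pair_comm]

theorem fb_add_dir (v : ℤ × ℤ) (i : Fin 6) : fb (v + dir i) (i + 2) = fb v i := by
  apply Subtype.ext
  rw [fb_val, fb_val, add_assoc, add_assoc, dir_add_two, show i + 2 + 1 = i + 3 from add_assoc i 2 1,
    dir_add_three, add_zero]
  ext x
  simp only [Finset.mem_insert, Finset.mem_singleton]
  tauto

theorem fb_add_dir_succ (v : ℤ × ℤ) (i : Fin 6) : fb (v + dir (i + 1)) (i + 4) = fb v i := by
  rw [← fb_add_dir v i, ← fb_add_dir (v + dir i) (i + 2), add_assoc v, dir_add_two,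
    show i + 2 + 2 = i + 4 from add_assoc i 2 2]

theorem card_vb (v : ℤ × ℤ) : (vb v).1.card = 1 := Finset.card_singleton v

theorem card_eb (v : ℤ × ℤ) (i : Fin 6) : (eb v i).1.card = 2 := Finset.card_pair (ne_add_dir v i)

theorem card_fb (v : ℤ × ℤ) (i : Fin 6) : (fb v i).1.card = 3 := (around v i).2.2

theorem exists_dir {d : ℤ × ℤ} (h0 : d ≠ 0) (h : d.1 ^ 2 + d.1 * d.2 + d.2 ^ 2 ≤ 1) :
    ∃ i, d = dir i := by
  obtain ⟨a, b⟩ := d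
  simp only at h
  -- The bounds come from `4 (a² + a b + b²) = 3 a² + (a + 2 b)²` and its mirror image.
  have ha1 : a ≤ 1 := by nlinarith [sq_nonneg (a + 2 * b)]
  have ha2 : -1 ≤ a := by nlinarith [sq_nonneg (a + 2 * b)]
  have hb1 : b ≤ 1 := by nlinarith [sq_nonneg (b + 2 * a)]
  have hb2 : -1 ≤ b := by nlinarith [sq_nonneg (b + 2 * a)]
  have key : ∀ a ∈ Finset.Icc (-1 : ℤ) 1, ∀ b ∈ Finset.Icc (-1 : ℤ) 1,
      a ^ 2 + a * b + b ^ 2 ≤ 1 → (a, b) ≠ (0, 0) → ∃ i, (a, b) = dir i := by decide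
  exact key a (Finset.mem_Icc.2 ⟨ha2, ha1⟩) b (Finset.mem_Icc.2 ⟨hb2, hb1⟩) h h0

/-- The simplices of the tiled plane that contain a given vertex. -/
theorem simplex_cases (s : ESimplex) {x : ℤ × ℤ} (hx : x ∈ s.1) :
    s = vb x ∨ (∃ i, s = eb x i) ∨ ∃ i, s = fb x i := by
  obtain ⟨s, hs⟩ := s
  simp only at hx
  -- The directions from `x` to the other vertices of `s`. Mutual distance at most 1 makes any two
  -- of them equal or consecutive, so there are at most two.
  let D : Finset (Fin 6) := Finset.univ.filter fun i => x + dir i ∈ s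
  have hs' : s = insert x (D.image fun i => x + dir i) := by
    ext y
    simp only [Finset.mem_insert, Finset.mem_image, D, Finset.mem_filter, Finset.mem_univ,
      true_and]
    constructor
    · intro hy
      by_cases hyx : y = x
      · exact Or.inl hyx
      · right
        have h := (dist_pos_le_one_iff y x).1 (hs.2 y hy x hx)
        obtain ⟨i, hi⟩ := exists_dir (d := y - x) (sub_ne_zero.2 hyx) h
        have hy' : x + dir i = y := by rw [← hi]; abel
        exact ⟨i, by rwa [hy'], hy'⟩
    · rintro (rfl | ⟨i, hi, rfl⟩)
      · exact hx
      · exact hi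
  have hD : ∀ i ∈ D, ∀ j ∈ D, i = j ∨ j = i + 1 ∨ i = j + 1 := by
    intro i hi j hj
    have h := (dist_pos_le_one_iff _ _).1
      (hs.2 _ (Finset.mem_filter.1 hi).2 _ (Finset.mem_filter.1 hj).2)
    rw [Prod.fst_add, Prod.fst_add, Prod.snd_add, Prod.snd_add, add_sub_add_left_eq_sub,
      add_sub_add_left_eq_sub] at h
    revert h
    have : ∀ i j : Fin 6, ((dir i).1 - (dir j).1) ^ 2 + ((dir i).1 - (dir j).1) *
        ((dir i).2 - (dir j).2) + ((dir i).2 - (dir j).2) ^ 2 ≤ 1 →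
        i = j ∨ j = i + 1 ∨ i = j + 1 := by decide
    exact this i j
  have hcases : ∀ D : Finset (Fin 6), (∀ i ∈ D, ∀ j ∈ D, i = j ∨ j = i + 1 ∨ i = j + 1) →
      D = ∅ ∨ (∃ i, D = {i}) ∨ ∃ i, D = {i, i + 1} := by decide
  rcases hcases D hD with h | ⟨i, h⟩ | ⟨i, h⟩
  · left
    exact Subtype.ext (hs'.trans (by rw [h]; rfl))
  · right; left
    exact ⟨i, Subtype.ext (hs'.trans (by rw [h, Finset.image_singleton]; rfl))⟩
  · right; right
    exact ⟨i, Subtype.ext (hs'.trans (by rw [h, Finset.image_insert, Finset.image_singleton]; rfl))⟩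

theorem eb_subset_eb {v : ℤ × ℤ} {i j : Fin 6} (h : (eb v i).1 ⊆ (eb v j).1) : i = j := by
  have h1 : v + dir i ∈ (eb v j).1 := h (by simp [eb_val])
  rw [eb_val, Finset.mem_insert, Finset.mem_singleton] at h1
  exact add_dir_inj (h1.resolve_left (ne_add_dir v i).symm)

theorem eb_subset_fb {v : ℤ × ℤ} {i j : Fin 6} (h : (eb v i).1 ⊆ (fb v j).1) :
    i = j ∨ i = j + 1 := by
  have h1 : v + dir i ∈ (fb v j).1 := h (by simp [eb_val])
  rw [fb_val, Finset.mem_insert, Finset.mem_insert, Finset.mem_singleton] at h1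
  exact (h1.resolve_left (ne_add_dir v i).symm).imp add_dir_inj add_dir_inj

theorem fb_subset_fb {v : ℤ × ℤ} {i j : Fin 6} (h : (fb v i).1 ⊆ (fb v j).1) : i = j := by
  have key : ∀ k, k = i ∨ k = i + 1 → k = j ∨ k = j + 1 := by
    intro k hk
    have h1 : v + dir k ∈ (fb v j).1 := h (by rcases hk with rfl | rfl <;> simp [fb_val])
    rw [fb_val, Finset.mem_insert, Finset.mem_insert, Finset.mem_singleton] at h1
    exact (h1.resolve_left (ne_add_dir v k).symm).imp add_dir_inj add_dir_inj
  clear h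
  revert i j
  decide

theorem eq_of_eb_eq {v w : ℤ × ℤ} {i j : Fin 6} (h : eb w j = eb v i) :
    (w = v ∧ j = i) ∨ (w = v + dir i ∧ j = i + 3) := by
  have h1 : w ∈ (eb v i).1 := by rw [← h]; simp [eb_val]
  rw [eb_val, Finset.mem_insert, Finset.mem_singleton] at h1
  rcases h1 with rfl | rfl
  · exact Or.inl ⟨rfl, eb_subset_eb (by rw [h])⟩
  · refine Or.inr ⟨rfl, eb_subset_eb (v := v + dir i) ?_⟩
    rw [h, eb_add_dir]

theorem eq_of_fb_eq {v w : ℤ × ℤ} {i j : Fin 6} (h : fb w j = fb v i) :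
    (w = v ∧ j = i) ∨ (w = v + dir i ∧ j = i + 2) ∨ (w = v + dir (i + 1) ∧ j = i + 4) := by
  have h1 : w ∈ (fb v i).1 := by rw [← h]; simp [fb_val]
  rw [fb_val, Finset.mem_insert, Finset.mem_insert, Finset.mem_singleton] at h1
  rcases h1 with rfl | rfl | rfl
  · exact Or.inl ⟨rfl, fb_subset_fb (by rw [h])⟩
  · refine Or.inr (Or.inl ⟨rfl, fb_subset_fb (v := v + dir i) ?_⟩)
    rw [h, fb_add_dir]
  · refine Or.inr (Or.inr ⟨rfl, fb_subset_fb (v := v + dir (i + 1)) ?_⟩)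
    rw [h, fb_add_dir_succ]

theorem vb_injective : Function.Injective vb := fun _ _ h =>
  Finset.singleton_injective (congrArg Subtype.val h)

theorem eb_injective (v : ℤ × ℤ) : Function.Injective (eb v) := fun _ _ h =>
  eb_subset_eb (by rw [h])

theorem fb_injective (v : ℤ × ℤ) : Function.Injective (fb v) := fun _ _ h =>
  fb_subset_fb (by rw [h])

theorem vb_ne_eb (v w : ℤ × ℤ) (i : Fin 6) : vb v ≠ eb w i := fun h => by
  have h1 := card_vb v
  rw [h, card_eb] at h1
  omega

theorem vb_ne_fb (v w : ℤ × ℤ) (i : Fin 6) : vb v ≠ fb w i := fun h => by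
  have h1 := card_vb v
  rw [h, card_fb] at h1
  omega

theorem eb_ne_fb (v w : ℤ × ℤ) (i j : Fin 6) : eb v i ≠ fb w j := fun h => by
  have h1 := card_eb v i
  rw [h, card_fb] at h1
  omega

/-- The number of the edge of a flag: the second edge at `v` of the face number `i` if `b` holds,
and the first one otherwise. -/
def flagEdge (i : Fin 6) (b : Bool) : Fin 6 := if b then i + 1 else i

/-- The triangle of the barycentric subdivision with vertices the vertex `v`, an edge and the
face number `i` around `v`. -/
def tri (v : ℤ × ℤ) (i : Fin 6) (b : Bool) : Triangle (sd E) :=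
  ⟨{vb v, eb v (flagEdge i b), fb v i}, by
    have h1 : (vb v).1 ⊆ (eb v (flagEdge i b)).1 := by
      change ({v} : Finset (ℤ × ℤ)) ⊆ _
      rw [eb_val]; simp
    have h2 : (eb v (flagEdge i b)).1 ⊆ (fb v i).1 := by
      rw [eb_val, fb_val]
      cases b <;> intro x <;>
        simp only [flagEdge, Finset.mem_insert, Finset.mem_singleton] <;> tauto
    refine ⟨⟨⟨vb v, by simp⟩, ?_⟩, ?_⟩
    · intro a ha b hb
      simp only [Finset.mem_insert, Finset.mem_singleton] at ha hb
      rcases ha with rfl | rfl | rfl <;> rcases hb with rfl | rfl | rfl <;>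
        first
          | exact Or.inl (Finset.Subset.refl _)
          | exact Or.inl h1
          | exact Or.inr h1
          | exact Or.inl h2
          | exact Or.inr h2
          | exact Or.inl (h1.trans h2)
          | exact Or.inr (h1.trans h2)
    · exact Finset.card_eq_three.2 ⟨_, _, _, vb_ne_eb _ _ _, vb_ne_fb _ _ _, eb_ne_fb _ _ _ _, rfl⟩⟩

theorem tri_val (v : ℤ × ℤ) (i : Fin 6) (b : Bool) :
    (tri v i b).1 = {vb v, eb v (flagEdge i b), fb v i} := rfl

theorem vb_mem_tri (v : ℤ × ℤ) (i : Fin 6) (b : Bool) : vb v ∈ (tri v i b).1 := by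
  simp [tri_val]

theorem eb_mem_tri (v : ℤ × ℤ) (i : Fin 6) (b : Bool) : eb v (flagEdge i b) ∈ (tri v i b).1 := by
  simp [tri_val]

theorem fb_mem_tri (v : ℤ × ℤ) (i : Fin 6) (b : Bool) : fb v i ∈ (tri v i b).1 := by
  simp [tri_val]

/-- Every chain of simplices of the tiled plane is contained in a flag. -/
theorem exists_subset_tri {c : Finset ESimplex} (hc : c ∈ (sd E).faces) :
    ∃ v i b, c ⊆ (tri v i b).1 := by
  -- Any vertex of the smallest simplex lies in the whole chain and can serve as the vertex of the
  -- flag.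
  obtain ⟨m, hm, hmin⟩ := c.exists_min_image (fun s => s.1.card) hc.1
  obtain ⟨x, hx⟩ := m.2.1
  have hxs : ∀ s ∈ c, x ∈ s.1 := by
    intro s hs
    rcases hc.2 m hm s hs with h | h
    · exact h hx
    · exact Finset.eq_of_subset_of_card_le h (hmin s hs) ▸ hx
  have hcases := fun s (hs : s ∈ c) => simplex_cases s (hxs s hs)
  by_cases hf : ∃ j, fb x j ∈ c
  · obtain ⟨j, hj⟩ := hf
    have hfj : ∀ k, fb x k ∈ c → k = j := by
      intro k hk
      rcases hc.2 _ hk _ hj with h | h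
      · exact fb_subset_fb h
      · exact (fb_subset_fb h).symm
    have hej : ∀ k, eb x k ∈ c → k = j ∨ k = j + 1 := by
      intro k hk
      rcases hc.2 _ hk _ hj with h | h
      · exact eb_subset_fb h
      · have := Finset.card_le_card h
        rw [card_fb, card_eb] at this
        omega
    by_cases he : eb x (j + 1) ∈ c
    · refine ⟨x, j, true, fun s hs => ?_⟩
      rcases hcases s hs with rfl | ⟨k, rfl⟩ | ⟨k, rfl⟩
      · exact vb_mem_tri _ _ _
      · have : k = j + 1 := by
          rcases hc.2 _ hs _ he with h | h
          · exact eb_subset_eb h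
          · exact (eb_subset_eb h).symm
        subst this
        exact eb_mem_tri x j true
      · rw [hfj k hs]
        exact fb_mem_tri _ _ _
    · refine ⟨x, j, false, fun s hs => ?_⟩
      rcases hcases s hs with rfl | ⟨k, rfl⟩ | ⟨k, rfl⟩
      · exact vb_mem_tri _ _ _
      · rcases hej k hs with rfl | rfl
        · exact eb_mem_tri x k false
        · exact (he hs).elim
      · rw [hfj k hs]
        exact fb_mem_tri _ _ _
  · by_cases he : ∃ i, eb x i ∈ c
    · obtain ⟨i, hi⟩ := he
      refine ⟨x, i, false, fun s hs => ?_⟩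
      rcases hcases s hs with rfl | ⟨k, rfl⟩ | ⟨k, rfl⟩
      · exact vb_mem_tri _ _ _
      · have : k = i := by
          rcases hc.2 _ hs _ hi with h | h
          · exact eb_subset_eb h
          · exact (eb_subset_eb h).symm
        subst this
        exact eb_mem_tri x k false
      · exact (hf ⟨k, hs⟩).elim
    · refine ⟨x, 0, false, fun s hs => ?_⟩
      rcases hcases s hs with rfl | ⟨k, rfl⟩ | ⟨k, rfl⟩
      · exact vb_mem_tri _ _ _
      · exact (he ⟨k, hs⟩).elim
      · exact (hf ⟨k, hs⟩).elim

theorem exists_tri_eq (t : Triangle (sd E)) : ∃ v i b, t = tri v i b := by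
  obtain ⟨v, i, b, h⟩ := exists_subset_tri t.2.1
  exact ⟨v, i, b, Subtype.ext
    (Finset.eq_of_subset_of_card_le h (by rw [t.2.2, (tri v i b).2.2]))⟩

theorem exists_around_eq (F : Triangle E) {x : ℤ × ℤ} (hx : x ∈ F.1) : ∃ i, F = around x i := by
  have h3 : (⟨F.1, F.2.1⟩ : ESimplex).1.card = 3 := F.2.2
  rcases simplex_cases ⟨F.1, F.2.1⟩ hx with h | ⟨i, h⟩ | ⟨i, h⟩
  · rw [h, card_vb] at h3; omega
  · rw [h, card_eb] at h3; omega
  · exact ⟨i, Subtype.ext (show F.1 = (fb x i).1 by rw [← h])⟩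

theorem liesIn_tri_iff {v : ℤ × ℤ} {i : Fin 6} {b : Bool} {F : Triangle E} :
    LiesIn (tri v i b) F ↔ F = around v i := by
  constructor
  · intro h
    have h3 : (⟨F.1, F.2.1⟩ : ESimplex).1.card = 3 := F.2.2
    rw [LiesIn, tri_val, Finset.mem_insert, Finset.mem_insert, Finset.mem_singleton] at h
    rcases h with h | h | h
    · rw [h, card_vb] at h3; omega
    · rw [h, card_eb] at h3; omega
    · exact Subtype.ext (show F.1 = (fb v i).1 by rw [← h])
  · rintro rfl
    exact fb_mem_tri v i b

theorem around_eq_of_fb_eq {v w : ℤ × ℤ} {i j : Fin 6} (h : fb v i = fb w j) :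
    around v i = around w j :=
  Subtype.ext (show (fb v i).1 = (fb w j).1 by rw [h])

/-- Two faces with a common edge are consecutive around a vertex. -/
theorem exists_consecutive {F F' : Triangle E} (h : (F.1 ∩ F'.1).card = 2) :
    ∃ v i, (F = around v i ∧ F' = around v (i + 1)) ∨ (F' = around v i ∧ F = around v (i + 1)) := by
  obtain ⟨x, y, hxy, hi⟩ := Finset.card_eq_two.1 h
  have hx : x ∈ F.1 ∩ F'.1 := by rw [hi]; simp
  have hy : y ∈ F.1 ∩ F'.1 := by rw [hi]; simp
  rw [Finset.mem_inter] at hx hy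
  obtain ⟨i, rfl⟩ := exists_around_eq F hx.1
  obtain ⟨j, rfl⟩ := exists_around_eq F' hx.2
  have hij : i ≠ j := by
    rintro rfl
    rw [Finset.inter_self, (around x i).2.2] at h
    omega
  have hmem : ∀ k, y ∈ (around x k).1 → y = x + dir k ∨ y = x + dir (k + 1) := by
    intro k hk
    change y ∈ ({x, x + dir k, x + dir (k + 1)} : Finset (ℤ × ℤ)) at hk
    rw [Finset.mem_insert, Finset.mem_insert, Finset.mem_singleton] at hk
    exact hk.resolve_left hxy.symm
  have key : j = i + 1 ∨ i = j + 1 := by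
    rcases hmem i hy.1 with h1 | h1 <;> rcases hmem j hy.2 with h2 | h2
    · exact (hij (add_dir_inj (h1.symm.trans h2))).elim
    · exact Or.inr (add_dir_inj (h1.symm.trans h2))
    · exact Or.inl (add_dir_inj (h1.symm.trans h2)).symm
    · exact (hij (add_right_cancel (add_dir_inj (h1.symm.trans h2)))).elim
  rcases key with rfl | rfl
  · exact ⟨x, i, Or.inl ⟨rfl, rfl⟩⟩
  · exact ⟨x, j, Or.inr ⟨rfl, rfl⟩⟩

theorem card_around_inter (v : ℤ × ℤ) (i : Fin 6) :
    ((around v i).1 ∩ (around v (i + 1)).1).card = 2 := by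
  have h : (around v i).1 ∩ (around v (i + 1)).1 = (eb v (i + 1)).1 := by
    change ({v, v + dir i, v + dir (i + 1)} : Finset (ℤ × ℤ)) ∩
      {v, v + dir (i + 1), v + dir (i + 1 + 1)} = {v, v + dir (i + 1)}
    ext y
    simp only [Finset.mem_inter, Finset.mem_insert, Finset.mem_singleton]
    constructor
    · rintro ⟨rfl | rfl | rfl, h⟩
      · exact Or.inl rfl
      · rcases h with h | h | h
        · exact Or.inl h
        · exact Or.inr h
        · exact ((by decide : ∀ i : Fin 6, i ≠ i + 1 + 1) i (add_dir_inj h)).elim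
      · exact Or.inr rfl
    · rintro (rfl | rfl) <;> simp
  rw [h, card_eb]


/-! ### The flat of a Pauli puzzle -/

theorem plane_induction {Q : ℤ × ℤ → Prop} (v : ℤ × ℤ) (h0 : Q v)
    (h : ∀ v i, Q v → Q (v + dir i)) (w : ℤ × ℤ) : Q w := by
  have hn : ∀ (i : Fin 6) (n : ℕ) (v : ℤ × ℤ), Q v → Q (v + n • dir i) := by
    intro i n
    induction n with
    | zero => intro v hv; simpa using hv
    | succ n ih =>
      intro v hv
      rw [succ_nsmul, ← add_assoc]
      exact h _ _ (ih v hv)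
  obtain ⟨i, -, n, m, rfl⟩ := Flat.exists_sector v w
  exact hn _ _ _ (hn _ _ _ h0)

theorem exists_int_sequence {H : Type} [Group H] (g : H) (r : ℤ → H) :
    ∃ h : ℤ → H, h 0 = g ∧ ∀ n, h (n + 1) = h n * r n := by
  let pos : ℕ → H := fun n => Nat.rec g (fun k x => x * r k) n
  let neg : ℕ → H := fun n => Nat.rec g (fun k x => x * (r (-((k : ℤ) + 1)))⁻¹) n
  -- `Int.negSucc k` is `-(k + 1)`, hence the shift of index.
  refine ⟨fun n => Int.rec pos (fun k => neg (k + 1)) n, rfl, fun n => ?_⟩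
  rcases n with n | n
  · rfl
  · cases n with
    | zero =>
      change g = g * (r (-((0 : ℕ) + 1 : ℤ)))⁻¹ * r (Int.negSucc 0)
      rw [show Int.negSucc 0 = (-((0 : ℕ) + 1 : ℤ)) from rfl, inv_mul_cancel_right]
    | succ n =>
      have h1 : Int.negSucc (n + 1) + 1 = Int.negSucc n := by omega
      rw [h1]
      change neg (n + 1) = neg (n + 1) * (r (-(((n + 1 : ℕ) : ℤ) + 1)))⁻¹ *
        r (Int.negSucc (n + 1))
      rw [show Int.negSucc (n + 1) = -(((n + 1 : ℕ) : ℤ) + 1) by omega, inv_mul_cancel_right]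

/-- A flat connection on the square lattice is integrable. -/
theorem exists_integral {H : Type} [Group H] (R S : ℤ × ℤ → H)
    (h : ∀ v, R v * S (v + (1, 0)) = S v * R (v + (0, 1))) :
    ∃ f : ℤ × ℤ → H, ∀ v, f (v + (1, 0)) = f v * R v ∧ f (v + (0, 1)) = f v * S v := by
  obtain ⟨row, -, hrow⟩ := exists_int_sequence 1 fun a => R (a, 0)
  choose col hcol0 hcol using fun a : ℤ => exists_int_sequence (row a) fun b => S (a, b)
  -- The columns are integrated from the row `b = 0`; flatness carries the horizontal relation up
  -- and down.
  have key : ∀ a b : ℤ, col (a + 1) b = col a b * R (a, b) := by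
    intro a b
    have hab : ∀ b, R (a, b) * S (a + 1, b) = S (a, b) * R (a, b + 1) := by
      intro b
      simpa using h (a, b)
    induction b using Int.induction_on with
    | zero => rw [hcol0, hcol0, hrow]
    | succ b ih => rw [hcol, hcol, ih, mul_assoc, hab, mul_assoc]
    | pred b ih =>
      have h1 := hcol (a + 1) (-b - 1)
      have h2 := hcol a (-b - 1)
      have h3 := hab (-b - 1)
      rw [sub_add_cancel] at h1 h2 h3
      rw [h1, h2, mul_assoc, ← h3, ← mul_assoc] at ih
      exact mul_right_cancel ih
  refine ⟨fun v => col v.1 v.2, fun v => ⟨?_, ?_⟩⟩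
  · simpa using key v.1 v.2
  · simpa using hcol v.1 v.2

/-- The element of `ℤ/3` that rotates `X` to a Pauli matrix. -/
def Pauli.shift : Pauli → Multiplicative (ZMod 3)
  | .X => 1
  | .Y => Multiplicative.ofAdd 1
  | .Z => Multiplicative.ofAdd 2

theorem Pauli.next_iterate_shift (M : Pauli) :
    Pauli.next^[(Multiplicative.toAdd M.shift).val] Pauli.X = M := by cases M <;> rfl

theorem Pauli.shift_next_iterate (k : Multiplicative (ZMod 3)) :
    (Pauli.next^[(Multiplicative.toAdd k).val] Pauli.X).shift = k := by
  revert k; decide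

/-- The rotation of `ℤ/3` attached to a Pauli matrix, as an element of `G`. -/
noncomputable def Pauli.rotG (M : Pauli) : G := inU (SemidirectProduct.inr M.shift)

/-- A Pauli matrix as an element of `G`. -/
noncomputable def Pauli.toG (M : Pauli) : G := inU M.toU

theorem toG_mul_toG (M : Pauli) : M.toG * M.toG = 1 := by
  rw [Pauli.toG, ← map_mul, inv_eq_iff_mul_eq_one.1 (toU_inv M), map_one]

theorem rotG_mul_cG (k : Multiplicative (ZMod 3)) :
    inU (SemidirectProduct.inr k) * cG = cG * inU (SemidirectProduct.inr k) := by
  rw [inU_inr, cG_eq]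
  exact (Commute.all _ _).map inW


/-- Conjugation by `T^k` here cycles the Pauli matrices in the direction opposite to the marking
`T^(-k) X T^k`. This is the origin of the exchange of `Y` and `Z`. -/
theorem rotG_mul_X (M : Pauli) : M.rotG * Pauli.X.toG = M.swapYZ.toG * M.rotG := by
  have hT : ∀ M : Pauli, M.toU * T = T * M.next.toU := by
    intro M
    rw [← inv_T_mul_toU_mul_T]
    group
  rw [Pauli.rotG, Pauli.toG, Pauli.toG, ← map_mul, ← map_mul]
  congr 1
  cases M
  · rw [Pauli.shift, map_one, one_mul, mul_one]
    rfl
  · exact (hT .Z).symm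
  · have h2 : (SemidirectProduct.inr Pauli.Z.shift : U) = T * T := by
      rw [T, ← map_mul]
      rfl
    rw [h2, ← mul_assoc]
    change T * T * (Pauli.next .Z).toU = Pauli.Y.toU * T * T
    rw [hT, mul_assoc, mul_assoc, ← hT .Z]
    rfl

/-- The braid relation of `X` and `c` in `V` is conjugated by a power of `T`, which commutes with
`c`. -/
theorem toG_braid (M : Pauli) : M.toG * cG * M.toG = cG * M.toG * cG := by
  have h := rotG_mul_X M.swapYZ
  rw [Pauli.swapYZ_swapYZ] at h
  have h1 : M.toG = M.swapYZ.rotG * Pauli.X.toG * M.swapYZ.rotG⁻¹ := by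
    rw [h, mul_inv_cancel_right]
  have h2 : M.swapYZ.rotG * cG = cG * M.swapYZ.rotG := rotG_mul_cG _
  have h3 : M.swapYZ.rotG⁻¹ * cG = cG * M.swapYZ.rotG⁻¹ := by
    rw [inv_mul_eq_iff_eq_mul, ← mul_assoc, h2, mul_inv_cancel_right]
  calc M.toG * cG * M.toG
      = M.swapYZ.rotG * Pauli.X.toG * (M.swapYZ.rotG⁻¹ * cG) * M.swapYZ.rotG * Pauli.X.toG *
          M.swapYZ.rotG⁻¹ := by rw [h1]; simp only [mul_assoc]
    _ = M.swapYZ.rotG * (Pauli.X.toG * cG * Pauli.X.toG) * M.swapYZ.rotG⁻¹ := by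
        rw [h3]; simp only [mul_assoc, inv_mul_cancel_left]
    _ = M.swapYZ.rotG * cG * Pauli.X.toG * (cG * M.swapYZ.rotG⁻¹) := by
        rw [Pauli.toG, X_mul_cG_pow]; simp only [mul_assoc]
    _ = cG * M.toG * cG := by rw [h2, ← h3, h1]; simp only [mul_assoc]

theorem tau_toG (M : Pauli) : tau M.toG = 1 := tau_inU _

theorem tau_rotG (M : Pauli) : tau M.rotG = M.shift := tau_inU _

/-- The label of a face: the mark up to transposition of `Y` and `Z`. -/
def Puzzle.label (p : Puzzle) (v : ℤ × ℤ) (i : Fin 6) : Pauli := (p.tile (around v i)).swapYZ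

theorem swapYZ_injective : Function.Injective Pauli.swapYZ := fun M N h => by
  rw [← Pauli.swapYZ_swapYZ M, h, Pauli.swapYZ_swapYZ]

theorem Puzzle.label_ne (p : Puzzle) (v : ℤ × ℤ) (i : Fin 6) : p.label v i ≠ p.label v (i + 1) :=
  fun h => p.adjacent _ _ (card_around_inter v i) (swapYZ_injective h)

theorem Puzzle.label_add_dir (p : Puzzle) (v : ℤ × ℤ) (i : Fin 6) :
    p.label (v + dir i) (i + 2) = p.label v i := by
  rw [Puzzle.label, around_eq_of_fb_eq (fb_add_dir v i), Puzzle.label]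

/-- The cyclic product of six Pauli matrices is trivial if and only if it is trivial in `G` after
the transposition of `Y` and `Z`. -/
theorem ring_iff (m : Fin 6 → Pauli) : (List.ofFn fun i => (m i).mat).prod = 1 ↔
    (m 0).swapYZ.toG * (m 1).swapYZ.toG * (m 2).swapYZ.toG * (m 3).swapYZ.toG *
      (m 4).swapYZ.toG * (m 5).swapYZ.toG = 1 := by
  have h1 : (List.ofFn fun i => (m i).mat).prod =
      ([m 0, m 1, m 2, m 3, m 4, m 5].map Pauli.mat).prod := by
    simp [List.ofFn_succ]
  have h2 : (m 0).swapYZ.toG * (m 1).swapYZ.toG * (m 2).swapYZ.toG * (m 3).swapYZ.toG *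
      (m 4).swapYZ.toG * (m 5).swapYZ.toG =
      inU (SemidirectProduct.inl (([(m 0).swapYZ, (m 1).swapYZ, (m 2).swapYZ, (m 3).swapYZ,
        (m 4).swapYZ, (m 5).swapYZ].map Pauli.toP).prod)) := by
    simp [Pauli.toG, Pauli.toU, mul_assoc]
  rw [h1, h2, map_eq_one_iff _ inU_injective,
    map_eq_one_iff _ SemidirectProduct.inl_injective, toP_list_prod_eq_one_iff,
    prod_mat_eq_one_iff, prod_mat_eq_one_iff]
  constructor
  · exact evalWord_swapYZ _ _ _ _ _ _
  · intro h
    have := evalWord_swapYZ _ _ _ _ _ _ h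
    simpa only [Pauli.swapYZ_swapYZ] using this

/-! ### Integration of a labelling to a flat -/

section

variable (L : ℤ × ℤ → Fin 6 → Pauli)

/-- The products of the labels of the first faces around a vertex. -/
noncomputable def partialProd (v : ℤ × ℤ) : Fin 6 → G :=
  ![1, (L v 0).toG, (L v 0).toG * (L v 1).toG, (L v 0).toG * (L v 1).toG * (L v 2).toG,
    (L v 0).toG * (L v 1).toG * (L v 2).toG * (L v 3).toG,
    (L v 0).toG * (L v 1).toG * (L v 2).toG * (L v 3).toG * (L v 4).toG]

/-- A labelling of the faces of the tiled plane with trivial products around the vertices comes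
from a flat. -/
theorem exists_flat (hL : ∀ v i, L v i ≠ L v (i + 1))
    (hdir : ∀ v i, L (v + dir i) (i + 2) = L v i)
    (hring : ∀ v, (L v 0).toG * (L v 1).toG * (L v 2).toG * (L v 3).toG * (L v 4).toG *
      (L v 5).toG = 1) : ∃ F : Flat, F.label = L := by
  have hsq : ∀ (M : Pauli) (x : G), M.toG * (M.toG * x) = x := fun M x => by
    rw [← mul_assoc, toG_mul_toG, one_mul]
  have hc : ∀ x : G, cG * (cG * x) = x := fun x => by rw [← mul_assoc, cG_mul_cG, one_mul]
  have hring' : ∀ v, (L v 3).toG * (L v 4).toG * (L v 5).toG *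
      ((L v 0).toG * (L v 1).toG * (L v 2).toG) = 1 := by
    intro v
    have := hring v
    rw [mul_eq_one_comm]
    simpa only [mul_assoc] using this
  have hring'' : ∀ v, (L v 4).toG * (L v 5).toG *
      ((L v 0).toG * (L v 1).toG * (L v 2).toG * (L v 3).toG) = 1 := by
    intro v
    have := hring v
    rw [mul_eq_one_comm]
    simpa only [mul_assoc] using this
  -- `h v` is to be the edge of direction 0 at `v`. The two transitions turn to direction 0 or 1,
  -- reverse the edge, and turn on to direction 0 at the neighbour.
  obtain ⟨h, hh⟩ := exists_integral
    (fun v => cG * ((L (v + dir 0) 3).toG * (L (v + dir 0) 4).toG * (L (v + dir 0) 5).toG))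
    (fun v => (L v 0).toG * cG * ((L (v + dir 1) 4).toG * (L (v + dir 1) 5).toG)) (by
      intro v
      change cG * ((L (v + dir 0) 3).toG * (L (v + dir 0) 4).toG * (L (v + dir 0) 5).toG) *
        ((L (v + dir 0) 0).toG * cG *
          ((L (v + dir 0 + dir 1) 4).toG * (L (v + dir 0 + dir 1) 5).toG)) =
        (L v 0).toG * cG * ((L (v + dir 1) 4).toG * (L (v + dir 1) 5).toG) *
        (cG * ((L (v + dir 1 + dir 0) 3).toG * (L (v + dir 1 + dir 0) 4).toG *
          (L (v + dir 1 + dir 0) 5).toG))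
      rw [add_right_comm v (dir 1) (dir 0)]
      have e1 : L (v + dir 0) 2 = L v 0 := hdir v 0
      have e2 : L (v + dir 1) 4 = L v 0 := by
        rw [← e1, ← hdir (v + dir 0) 2, add_assoc, show dir 0 + dir 2 = dir 1 from rfl]
        rfl
      have e3 : L (v + dir 0 + dir 1) 3 = L (v + dir 0) 1 := hdir (v + dir 0) 1
      have e4 : L (v + dir 1) 5 = L (v + dir 0) 1 := by
        rw [← e3, ← hdir (v + dir 0 + dir 1) 3, add_assoc, add_assoc,
          show dir 0 + (dir 1 + dir 3) = dir 1 from rfl]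
        rfl
      -- The vertex condition at `v + dir 0` replaces four turns by the two through the faces of the
      -- rhombus. The braid relations of these two faces then give zero curvature.
      have e5 : (L (v + dir 0) 3).toG * (L (v + dir 0) 4).toG * (L (v + dir 0) 5).toG *
          (L (v + dir 0) 0).toG = (L v 0).toG * (L (v + dir 0) 1).toG := by
        have := hring' (v + dir 0)
        rw [← mul_assoc, ← mul_assoc, mul_eq_one_iff_eq_inv, e1] at this
        have h1 := congrArg (· * (L (v + dir 0) 1).toG) this
        simp only [mul_assoc, toG_mul_toG, mul_one] at h1
        rw [inv_eq_of_mul_eq_one_left (toG_mul_toG _)] at h1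
        simpa only [mul_assoc] using h1
      generalize L (v + dir 0 + dir 1) 4 = l4 at *
      generalize L (v + dir 0 + dir 1) 5 = l5 at *
      rw [e2, e3, e4]
      generalize L v 0 = A at *
      generalize L (v + dir 0) 1 = B at *
      have b1 := toG_braid A
      have b2 := toG_braid B
      calc _ = cG * ((L (v + dir 0) 3).toG * (L (v + dir 0) 4).toG * (L (v + dir 0) 5).toG *
            (L (v + dir 0) 0).toG) * (cG * (l4.toG * l5.toG)) := by simp only [mul_assoc]
        _ = (cG * A.toG * cG) * (cG * B.toG * cG) * (l4.toG * l5.toG) := by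
            rw [e5]; simp only [mul_assoc, hc]
        _ = _ := by rw [← b1, ← b2]; simp only [mul_assoc])
  have hturn : ∀ v i, h v * partialProd L v (i + 1) =
      h v * partialProd L v i * inU (L v i).toU := by
    intro v i
    rw [mul_assoc]
    congr 1
    fin_cases i
    · exact (one_mul _).symm
    · rfl
    · rfl
    · rfl
    · rfl
    · exact (hring v).symm
  let e : ℤ × ℤ → Fin 6 → G := fun v i => h v * partialProd L v i
  have hturn : ∀ v i, e v (i + 1) = e v i * (L v i).toG := hturn
  have r0 : ∀ v, e (v + dir 0) 3 = e v 0 * cG := by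
    intro v
    change h (v + (1, 0)) * ((L (v + dir 0) 0).toG * (L (v + dir 0) 1).toG *
      (L (v + dir 0) 2).toG) = h v * 1 * cG
    rw [(hh v).1, mul_assoc, mul_assoc cG, hring', mul_one, mul_one]
  have r1 : ∀ v, e (v + dir 1) 4 = e v 1 * cG := by
    intro v
    change h (v + (0, 1)) * ((L (v + dir 1) 0).toG * (L (v + dir 1) 1).toG *
      (L (v + dir 1) 2).toG * (L (v + dir 1) 3).toG) = h v * (L v 0).toG * cG
    rw [(hh v).2, mul_assoc, mul_assoc (_ * cG), hring'', mul_one, mul_assoc]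
  -- Two sides of the face `v`, `v + dir 1`, `v + dir 2` are already known to reverse correctly; its
  -- braid relation gives the third.
  have r2 : ∀ v, e (v + dir 2) 5 = e v 2 * cG := by
    intro v
    have e1 : L (v + dir 2) 5 = L v 1 := by
      have h1 := hdir v 1
      have h2 := hdir (v + dir 1) 3
      rw [add_assoc, show dir 1 + dir 3 = dir 2 from rfl] at h2
      exact h2.trans h1
    have e2 : L (v + dir 1) 3 = L v 1 := hdir v 1
    have s1 : e v 2 = e v 1 * (L v 1).toG := hturn v 1
    have s2 : e (v + dir 1) 4 = e (v + dir 1) 3 * (L v 1).toG := by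
      rw [← e2]; exact hturn (v + dir 1) 3
    have s3 : e (v + dir 2) 0 = e (v + dir 2) 5 * (L v 1).toG := by
      rw [← e1]; exact hturn (v + dir 2) 5
    have s4 : e (v + dir 1) 3 = e (v + dir 2) 0 * cG := by
      have := r0 (v + dir 2)
      rwa [add_assoc, show dir 2 + dir 0 = dir 1 from rfl] at this
    have s5 := r1 v
    generalize L v 1 = A at *
    have b := toG_braid A
    rw [s2, s4, s3] at s5
    have s6 : e v 1 = e (v + dir 2) 5 * (A.toG * cG * A.toG) * cG := by
      have := congrArg (· * cG) s5
      simp only [mul_assoc, cG_mul_cG, mul_one] at this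
      simp only [mul_assoc, ← this]
    rw [s1, s6, b]
    simp only [mul_assoc, hsq, cG_mul_cG, mul_one]
  have rinv : ∀ v i, (∀ v, e (v + dir (i + 3)) (i + 3 + 3) = e v (i + 3) * cG) →
      e (v + dir i) (i + 3) = e v i * cG := by
    intro v i hi
    have := hi (v + dir i)
    rw [add_assoc, dir_add_three, add_zero,
      (by decide : ∀ i : Fin 6, i + 3 + 3 = i) i] at this
    rw [this, mul_assoc, cG_mul_cG, mul_one]
  refine ⟨⟨e, L, hturn, fun v i => ?_, hL⟩, rfl⟩
  fin_cases i
  · exact r0 v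
  · exact r1 v
  · exact r2 v
  · exact rinv v 3 r0
  · exact rinv v 4 r1
  · exact rinv v 5 r2

end

namespace Flat

/-- The left translate of a flat. -/
noncomputable def translate (F : Flat) (x : G) : Flat where
  edge v i := x * F.edge v i
  label := F.label
  turn v i := by rw [F.turn, mul_assoc]
  reverse v i := by rw [F.reverse, mul_assoc]
  label_ne := F.label_ne

theorem tau_edge_eq (F : Flat) (v w : ℤ × ℤ) (i j : Fin 6) :
    tau (F.edge v i) = tau (F.edge w j) := by
  have h1 : ∀ v i, tau (F.edge v i) = tau (F.edge v 0) := by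
    intro v i
    induction i using Fin.induction with
    | zero => rfl
    | succ i ih =>
      rw [← Fin.coeSucc_eq_succ, F.turn, map_mul, ih]
      exact (congrArg _ (tau_toG _)).trans (mul_one _)
  have h2 : ∀ w, tau (F.edge w 0) = tau (F.edge v 0) := by
    refine plane_induction (Q := fun w => tau (F.edge w 0) = tau (F.edge v 0)) v rfl ?_
    intro w k hw
    rw [← h1 (w + dir k) (k + 3), F.reverse, map_mul, tau_cG, mul_one, h1, hw]
  rw [h1 v, h1 w, h2 w]

end Flat

theorem Puzzle.exists_flat (p : Puzzle) (v : ℤ × ℤ) (i : Fin 6) :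
    ∃ F : Flat, F.label = p.label ∧ F.edge v i = 1 ∧ ∀ w j, tau (F.edge w j) = 1 := by
  obtain ⟨F, hF⟩ := PauliPuzzle.exists_flat p.label p.label_ne p.label_add_dir
    (fun v => (ring_iff fun i => p.tile (around v i)).1 (p.ring v))
  have h1 : (F.translate (F.edge v i)⁻¹).edge v i = 1 := inv_mul_cancel _
  exact ⟨F.translate (F.edge v i)⁻¹, hF, h1, fun w j => by
    rw [Flat.tau_edge_eq _ w v j i, h1, map_one]⟩


/-! ### The embedding of a Pauli puzzle -/

theorem mk_eq_iff {k : Corner} {g h : G} :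
    (QuotientGroup.mk g : G ⧸ stab k) = QuotientGroup.mk h ↔ g⁻¹ * h ∈ stab k :=
  QuotientGroup.eq

theorem mem_stab_u {g : G} : g ∈ stab .u ↔ ∃ u, inU u = g := Iff.rfl

theorem mem_stab_v {g : G} : g ∈ stab .v ↔ ∃ v, inV v = g := Iff.rfl

theorem mem_stab_w {g : G} : g ∈ stab .w ↔ ∃ w, inW w = g := Iff.rfl

/-- The vertex of the triangle `g t₀` with a given type. -/
noncomputable def vertexMk (k : Corner) (g : G) : Vertex := ⟨k, QuotientGroup.mk g⟩

theorem vertexMk_eq_iff {k k' : Corner} {g h : G} :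
    vertexMk k g = vertexMk k' h ↔ k = k' ∧ g⁻¹ * h ∈ stab k := by
  constructor
  · intro he
    obtain rfl : k = k' := congrArg Sigma.fst he
    exact ⟨rfl, mk_eq_iff.1 (eq_of_heq (Sigma.mk.inj he).2)⟩
  · rintro ⟨rfl, h⟩
    exact congrArg (Sigma.mk k) (mk_eq_iff.2 h)

theorem vertexMk_mul {k : Corner} {g h : G} (hh : h ∈ stab k) :
    vertexMk k (g * h) = vertexMk k g :=
  (vertexMk_eq_iff.2 ⟨rfl, by rwa [inv_mul_cancel_left]⟩).symm

theorem mem_chamber_iff {x : Vertex} {g : G} : x ∈ chamber g ↔ ∃ k, x = vertexMk k g := by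
  rw [chamber, Finset.mem_map]
  constructor
  · rintro ⟨k, -, rfl⟩; exact ⟨k, rfl⟩
  · rintro ⟨k, rfl⟩; exact ⟨k, Finset.mem_univ k, rfl⟩

theorem vertexMk_mem_chamber_iff {k : Corner} {g h : G} :
    vertexMk k g ∈ chamber h ↔ vertexMk k g = vertexMk k h := by
  rw [mem_chamber_iff]
  constructor
  · rintro ⟨k', hk⟩
    obtain ⟨rfl, -⟩ := vertexMk_eq_iff.1 hk
    exact hk
  · intro h; exact ⟨k, h⟩

theorem rotG_mem_stab_u (M : Pauli) : M.rotG ∈ stab .u := ⟨_, rfl⟩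

theorem rotG_mem_stab_w (M : Pauli) : M.rotG ∈ stab .w := ⟨_, (inU_inr M.shift).symm⟩

theorem cG_mem_stab_w : cG ∈ stab .w := ⟨_, cG_eq.symm⟩

theorem cG_mem_stab_v : cG ∈ stab .v := ⟨_, rfl⟩

theorem X_mem_stab_v : Pauli.X.toG ∈ stab .v := ⟨_, inU_X.symm⟩

/-- The elements of the image of `V`. -/
theorem stab_v_cases {g : G} (hg : g ∈ stab .v) :
    ∃ x : G, (x = 1 ∨ x = cG ∨ x = Pauli.X.toG * cG) ∧
      (g = x ∨ g = x * Pauli.X.toG) := by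
  obtain ⟨v, rfl⟩ := hg
  change ∃ x : G, _ ∧ (inV v = x ∨ inV v = x * Pauli.X.toG)
  have hX : inV (Equiv.swap 0 1) = Pauli.X.toG := inU_X.symm
  have hc : inV (Equiv.swap 1 2) = cG := rfl
  rcases perm_three_cases v with rfl | rfl | rfl | rfl | rfl | rfl
  · exact ⟨1, Or.inl rfl, Or.inl (map_one _)⟩
  · exact ⟨1, Or.inl rfl, Or.inr (by rw [hX, one_mul])⟩
  · exact ⟨cG, Or.inr (Or.inl rfl), Or.inl hc⟩
  · exact ⟨_, Or.inr (Or.inr rfl), Or.inl (by rw [map_mul, hX, hc])⟩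
  · exact ⟨_, Or.inr (Or.inl rfl), Or.inr (by rw [map_mul, hX, hc])⟩
  · exact ⟨_, Or.inr (Or.inr rfl), Or.inr (by rw [map_mul, map_mul, hX, hc, mul_assoc])⟩

/-- A flat together with a Pauli puzzle from which it arises. -/
structure PuzzleFlat where
  puzzle : Puzzle
  flat : Flat
  label_eq : flat.label = puzzle.label
  tau_eq : ∀ v i, tau (flat.edge v i) = 1

namespace PuzzleFlat

variable (D : PuzzleFlat)

/-- The rotation attached to the face number `i` around `v`. -/
noncomputable def rot (v : ℤ × ℤ) (i : Fin 6) : G := (D.puzzle.tile (around v i)).rotG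

/-- The element of `G` attached to a flag. -/
noncomputable def elt (v : ℤ × ℤ) (i : Fin 6) (b : Bool) : G :=
  D.flat.edge v (flagEdge i b) * D.rot v i

theorem rot_eq_of_fb_eq {v w : ℤ × ℤ} {i j : Fin 6} (h : fb v i = fb w j) :
    D.rot v i = D.rot w j := by
  rw [rot, around_eq_of_fb_eq h, rot]

theorem turn_mul_rot (v : ℤ × ℤ) (i : Fin 6) :
    D.flat.edge v (i + 1) * D.rot v i = D.flat.edge v i * D.rot v i * Pauli.X.toG := by
  have h : D.rot v i * Pauli.X.toG = (D.flat.label v i).toG * D.rot v i := by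
    rw [rot, rotG_mul_X, D.label_eq, Puzzle.label]
  rw [mul_assoc, h, D.flat.turn, mul_assoc]
  rfl

theorem rot_mul_cG (v : ℤ × ℤ) (i : Fin 6) : D.rot v i * cG = cG * D.rot v i := rotG_mul_cG _

theorem reverse_mul_rot (v : ℤ × ℤ) (i : Fin 6) :
    D.flat.edge (v + dir i) (i + 3) * D.rot v i = D.flat.edge v i * D.rot v i * cG := by
  rw [D.flat.reverse, mul_assoc, mul_assoc, rot_mul_cG]

theorem elt_true (v : ℤ × ℤ) (i : Fin 6) :
    D.elt v i true = D.elt v i false * Pauli.X.toG := D.turn_mul_rot v i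

theorem elt_add_dir (v : ℤ × ℤ) (i : Fin 6) :
    D.elt (v + dir i) (i + 2) true = D.elt v i false * cG := by
  rw [elt, D.rot_eq_of_fb_eq (fb_add_dir v i)]
  change D.flat.edge _ (i + 2 + 1) * _ = _
  rw [show i + 2 + 1 = i + 3 from add_assoc i 2 1, reverse_mul_rot]
  rfl

theorem elt_add_dir_false (v : ℤ × ℤ) (i : Fin 6) :
    D.elt (v + dir i) (i + 2) false = D.elt v i false * (cG * Pauli.X.toG) := by
  rw [← mul_assoc, ← elt_add_dir, elt_true, mul_assoc, toG_mul_toG, mul_one]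

/-- A vertex lies in a face if and only if its coset of `U` meets the coset of `V`. -/
theorem mem_fb_iff (v x : ℤ × ℤ) (i : Fin 6) : x ∈ (fb v i).1 ↔
    ∃ y ∈ stab .v, ∃ u, D.flat.edge x 0 = D.elt v i false * y * inU u := by
  have hu : ∀ w j, ∃ u, D.flat.edge w 0 = D.flat.edge w j * inU u :=
    fun w j => D.flat.exists_edge_eq w j 0
  have e0 : D.flat.edge v i = D.elt v i false * (D.rot v i)⁻¹ := by
    rw [elt, mul_inv_cancel_right]
    rfl
  have hrot : (D.rot v i)⁻¹ ∈ stab .u := inv_mem (rotG_mem_stab_u _)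
  have e1 : D.flat.edge (v + dir i) (i + 3) = D.elt v i false * cG * (D.rot v i)⁻¹ := by
    rw [eq_mul_inv_iff_mul_eq, reverse_mul_rot]
    rfl
  have e2 : D.flat.edge (v + dir (i + 1)) (i + 1 + 3) =
      D.elt v i false * (Pauli.X.toG * cG) * (D.rot v i)⁻¹ := by
    rw [eq_mul_inv_iff_mul_eq, D.flat.reverse, mul_assoc, ← rot_mul_cG, ← mul_assoc,
      turn_mul_rot, mul_assoc]
    rfl
  obtain ⟨u0, hu0⟩ := mem_stab_u.1 hrot
  rw [← hu0] at e0 e1 e2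
  rw [fb_val, Finset.mem_insert, Finset.mem_insert, Finset.mem_singleton]
  constructor
  · rintro (rfl | rfl | rfl)
    · obtain ⟨u, h⟩ := hu x i
      exact ⟨1, one_mem _, u0 * u, by rw [h, e0, mul_one, map_mul, mul_assoc]⟩
    · obtain ⟨u, h⟩ := hu (v + dir i) (i + 3)
      exact ⟨cG, cG_mem_stab_v, u0 * u, by rw [h, e1, map_mul, mul_assoc _ _ (inU u)]⟩
    · obtain ⟨u, h⟩ := hu (v + dir (i + 1)) (i + 1 + 3)
      exact ⟨Pauli.X.toG * cG, mul_mem X_mem_stab_v cG_mem_stab_v, u0 * u, by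
        rw [h, e2, map_mul, mul_assoc _ _ (inU u)]⟩
  · rintro ⟨y, hy, u, h⟩
    -- A right factor `X` is absorbed into `U`. The remaining representatives `1`, `c`, `X c`
    -- correspond to the three corners of the face.
    obtain ⟨z, hz, hyz⟩ := stab_v_cases hy
    obtain ⟨u', h'⟩ : ∃ u', D.flat.edge x 0 = D.elt v i false * z * inU u' := by
      rcases hyz with rfl | rfl
      · exact ⟨u, h⟩
      · refine ⟨Pauli.X.toU * u, ?_⟩
        rw [h, map_mul, Pauli.toG]
        simp only [mul_assoc]
    have key : ∀ w j, D.flat.edge w j = D.elt v i false * z * inU u0 → x = w := by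
      intro w j hw
      refine (D.flat.eq_of_edge_eq (u := u0⁻¹ * u') (i := j) (j := 0) ?_).symm
      rw [h', hw, map_mul, map_inv, mul_assoc, mul_assoc, mul_assoc, mul_inv_cancel_left]
    rcases hz with rfl | rfl | rfl
    · exact Or.inl (key v i (by rw [e0, mul_one]))
    · exact Or.inr (Or.inl (key _ _ e1))
    · exact Or.inr (Or.inr (key _ _ e2))

/-- A vertex lies on an edge if and only if its coset of `U` meets the coset of `W`. -/
theorem mem_eb_iff (v x : ℤ × ℤ) (i : Fin 6) : x ∈ (eb v i).1 ↔
    ∃ y ∈ stab .w, ∃ u, D.flat.edge x 0 = D.flat.edge v i * y * inU u := by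
  rw [eb_val, Finset.mem_insert, Finset.mem_singleton]
  constructor
  · rintro (rfl | rfl)
    · obtain ⟨u, h⟩ := D.flat.exists_edge_eq x i 0
      exact ⟨1, one_mem _, u, by rw [h, mul_one]⟩
    · obtain ⟨u, h⟩ := D.flat.exists_edge_eq (v + dir i) (i + 3) 0
      exact ⟨cG, cG_mem_stab_w, u, by rw [h, D.flat.reverse]⟩
  · rintro ⟨_, ⟨w, rfl⟩, u, h⟩
    change _ = _ * inW w * _ at h
    obtain ⟨k, hk | hk⟩ := inW_cases w
    · left
      rw [hk, mul_assoc, ← map_mul] at h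
      exact (D.flat.eq_of_edge_eq h).symm
    · right
      rw [hk, rotG_mul_cG, ← mul_assoc, ← D.flat.reverse, mul_assoc, ← map_mul] at h
      exact (D.flat.eq_of_edge_eq h).symm

theorem mem_vb_iff (v x : ℤ × ℤ) : x ∈ (vb v).1 ↔
    ∃ y ∈ stab .u, ∃ u, D.flat.edge x 0 = D.flat.edge v 0 * y * inU u := by
  change x ∈ ({v} : Finset (ℤ × ℤ)) ↔ _
  rw [Finset.mem_singleton]
  constructor
  · rintro rfl
    exact ⟨1, one_mem _, 1, by simp⟩
  · rintro ⟨_, ⟨y, rfl⟩, u, h⟩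
    change _ = _ * inU y * _ at h
    rw [mul_assoc, ← map_mul] at h
    exact (D.flat.eq_of_edge_eq h).symm

/-- Simplices whose vertices are described by the same coset are equal. -/
theorem eq_of_coset_eq {k : Corner} {s s' : ESimplex} {g g' : G}
    (hs : ∀ x, x ∈ s.1 ↔ ∃ y ∈ stab k, ∃ u, D.flat.edge x 0 = g * y * inU u)
    (hs' : ∀ x, x ∈ s'.1 ↔ ∃ y ∈ stab k, ∃ u, D.flat.edge x 0 = g' * y * inU u)
    (h : vertexMk k g = vertexMk k g') : s = s' := by
  have h1 := (vertexMk_eq_iff.1 h).2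
  apply Subtype.ext
  ext x
  rw [hs, hs']
  constructor
  · rintro ⟨y, hy, u, hx⟩
    exact ⟨(g⁻¹ * g')⁻¹ * y, mul_mem (inv_mem h1) hy, u, by rw [hx]; group⟩
  · rintro ⟨y, hy, u, hx⟩
    exact ⟨(g⁻¹ * g') * y, mul_mem h1 hy, u, by rw [hx]; group⟩

open Classical in
/-- The map from the simplices of the plane to the vertices of the development. -/
noncomputable def toVertex (s : ESimplex) : Vertex :=
  if h : ∃ v, s = vb v then vertexMk .u (D.flat.edge h.choose 0)
  else if h : ∃ q : (ℤ × ℤ) × Fin 6, s = eb q.1 q.2 then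
    vertexMk .w (D.flat.edge h.choose.1 h.choose.2)
  else if h : ∃ q : (ℤ × ℤ) × Fin 6, s = fb q.1 q.2 then
    vertexMk .v (D.elt h.choose.1 h.choose.2 false)
  else vertexMk .u 1

theorem toVertex_vb (v : ℤ × ℤ) : D.toVertex (vb v) = vertexMk .u (D.flat.edge v 0) := by
  have h : ∃ w, vb v = vb w := ⟨v, rfl⟩
  rw [toVertex, dif_pos h, ← vb_injective h.choose_spec]

theorem toVertex_eb (v : ℤ × ℤ) (i : Fin 6) :
    D.toVertex (eb v i) = vertexMk .w (D.flat.edge v i) := by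
  have h1 : ¬ ∃ w, eb v i = vb w := fun ⟨w, h⟩ => vb_ne_eb _ _ _ h.symm
  have h : ∃ q : (ℤ × ℤ) × Fin 6, eb v i = eb q.1 q.2 := ⟨(v, i), rfl⟩
  rw [toVertex, dif_neg h1, dif_pos h]
  generalize hq : h.choose = q
  have hs := h.choose_spec
  rw [hq] at hs
  obtain ⟨w, j⟩ := q
  rcases eq_of_eb_eq hs.symm with ⟨rfl, rfl⟩ | ⟨rfl, rfl⟩
  · rfl
  · simp only
    rw [D.flat.reverse, vertexMk_mul cG_mem_stab_w]

theorem toVertex_fb (v : ℤ × ℤ) (i : Fin 6) :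
    D.toVertex (fb v i) = vertexMk .v (D.elt v i false) := by
  have h1 : ¬ ∃ w, fb v i = vb w := fun ⟨w, h⟩ => vb_ne_fb _ _ _ h.symm
  have h2 : ¬ ∃ q : (ℤ × ℤ) × Fin 6, fb v i = eb q.1 q.2 := fun ⟨w, h⟩ => eb_ne_fb _ _ _ _ h.symm
  have h : ∃ q : (ℤ × ℤ) × Fin 6, fb v i = fb q.1 q.2 := ⟨(v, i), rfl⟩
  have step : ∀ v i, vertexMk .v (D.elt (v + dir i) (i + 2) false) =
      vertexMk .v (D.elt v i false) := by
    intro v i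
    rw [elt_add_dir_false, vertexMk_mul (mul_mem cG_mem_stab_v X_mem_stab_v)]
  rw [toVertex, dif_neg h1, dif_neg h2, dif_pos h]
  generalize hq : h.choose = q
  have hs := h.choose_spec
  rw [hq] at hs
  obtain ⟨w, j⟩ := q
  rcases eq_of_fb_eq hs.symm with ⟨rfl, rfl⟩ | ⟨rfl, rfl⟩ | ⟨rfl, rfl⟩
  · rfl
  · exact step v i
  · have := step (v + dir i) (i + 2)
    rw [add_assoc v, dir_add_two, add_assoc i, step] at this
    exact this

theorem toVertex_mem_chamber {v : ℤ × ℤ} {i : Fin 6} {b : Bool} {s : ESimplex}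
    (hs : s ∈ (tri v i b).1) : D.toVertex s ∈ chamber (D.elt v i b) := by
  rw [tri_val, Finset.mem_insert, Finset.mem_insert, Finset.mem_singleton] at hs
  rw [mem_chamber_iff]
  rcases hs with rfl | rfl | rfl
  · refine ⟨.u, ?_⟩
    obtain ⟨u, hu⟩ := D.flat.exists_edge_eq v 0 (flagEdge i b)
    rw [toVertex_vb, elt, hu, mul_assoc,
      vertexMk_mul (mul_mem (mem_stab_u.2 ⟨u, rfl⟩)
        (show D.rot v i ∈ stab .u from rotG_mem_stab_u _))]
  · refine ⟨.w, ?_⟩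
    rw [toVertex_eb, elt, vertexMk_mul (show D.rot v i ∈ stab .w from rotG_mem_stab_w _)]
  · refine ⟨.v, ?_⟩
    cases b
    · exact D.toVertex_fb v i
    · rw [elt_true, vertexMk_mul X_mem_stab_v, toVertex_fb]

/-- Simplices of different dimension get cosets of different groups. In equal dimension the coset
determines the vertices of the simplex, since distinct vertices of the flat have distinct cosets of
`U`. -/
theorem toVertex_injective : Function.Injective D.toVertex := by
  intro s s' h
  obtain ⟨x, hx⟩ := s.2.1
  obtain ⟨x', hx'⟩ := s'.2.1
  rcases simplex_cases s hx with rfl | ⟨i, rfl⟩ | ⟨i, rfl⟩ <;>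
    rcases simplex_cases s' hx' with rfl | ⟨i', rfl⟩ | ⟨i', rfl⟩ <;>
    simp only [toVertex_vb, toVertex_eb, toVertex_fb] at h
  · exact D.eq_of_coset_eq (fun y => D.mem_vb_iff _ y) (fun y => D.mem_vb_iff _ y) h
  · cases (vertexMk_eq_iff.1 h).1
  · cases (vertexMk_eq_iff.1 h).1
  · cases (vertexMk_eq_iff.1 h).1
  · exact D.eq_of_coset_eq (fun y => D.mem_eb_iff _ y _) (fun y => D.mem_eb_iff _ y _) h
  · cases (vertexMk_eq_iff.1 h).1
  · cases (vertexMk_eq_iff.1 h).1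
  · cases (vertexMk_eq_iff.1 h).1
  · exact D.eq_of_coset_eq (fun y => D.mem_fb_iff _ y _) (fun y => D.mem_fb_iff _ y _) h

/-- The simplicial embedding defined by a Pauli puzzle and its flat. -/
noncomputable def embedding : SimplicialEmbedding (sd E) Δ where
  toEmbedding := ⟨D.toVertex, D.toVertex_injective⟩
  map_mem c hc := by
    obtain ⟨v, i, b, h⟩ := exists_subset_tri hc
    refine ⟨Finset.map_nonempty.2 hc.1, D.elt v i b, ?_⟩
    intro x hx
    obtain ⟨s, hs, rfl⟩ := Finset.mem_map.1 hx
    exact D.toVertex_mem_chamber (h hs)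

theorem mapTriangle_embedding (v : ℤ × ℤ) (i : Fin 6) (b : Bool) :
    D.embedding.mapTriangle (tri v i b) = chamberΔ (D.elt v i b) := by
  apply Subtype.ext
  refine Finset.eq_of_subset_of_card_le ?_ ?_
  · intro x hx
    obtain ⟨s, hs, rfl⟩ := Finset.mem_map.1 hx
    exact D.toVertex_mem_chamber hs
  · rw [(chamberΔ _).2.2, (D.embedding.mapTriangle (tri v i b)).2.2]

theorem preservesMarks : PreservesMarks D.puzzle D.embedding := by
  intro s F hF
  obtain ⟨v, i, b, rfl⟩ := exists_tri_eq s
  obtain rfl := liesIn_tri_iff.1 hF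
  rw [mapTriangle_embedding, mark_chamberΔ, elt, map_mul, D.tau_eq, one_mul, rot, tau_rotG,
    Pauli.next_iterate_shift]

end PuzzleFlat

/-- Every pointed Pauli puzzle comes from an embedding. -/
theorem exists_embedding (t : Triangle (sd E)) (p : PointedPuzzle t) :
    ∃ f : PointedEmbedding t, PreservesMarks p.1 f.1 := by
  obtain ⟨v, i, b, rfl⟩ := exists_tri_eq t
  obtain ⟨F, hF, h1, ht⟩ := p.1.exists_flat v (flagEdge i b)
  let D : PuzzleFlat := ⟨p.1, F, hF, ht⟩
  refine ⟨⟨D.embedding, ?_⟩, D.preservesMarks⟩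
  rw [D.mapTriangle_embedding, t₀]
  congr 1
  -- The flat has been translated so that the edge of `t` is 1. The mark `X` at `t` makes the
  -- rotation trivial too, so `t` goes to `t₀`.
  have hX : p.1.tile (around v i) = .X := p.2 _ (liesIn_tri_iff.2 rfl)
  change F.edge v (flagEdge i b) * (p.1.tile (around v i)).rotG = 1
  rw [h1, hX, one_mul]
  exact (congrArg inU (map_one _)).trans (map_one _)


/-! ### The Pauli puzzle of an embedding -/

/-- The intersections `U ∩ V = {1, X}` and `U ∩ W = ⟨T⟩` meet trivially in `U`. -/
theorem chamber_injective {g h : G} (hgh : chamber g = chamber h) : g = h := by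
  have hk : ∀ k, g⁻¹ * h ∈ stab k := by
    intro k
    have h1 : vertexMk k g ∈ chamber h := hgh ▸ mem_chamber_iff.2 ⟨k, rfl⟩
    exact (vertexMk_eq_iff.1 (vertexMk_mem_chamber_iff.1 h1)).2
  obtain ⟨u, hu⟩ := mem_stab_u.1 (hk .u)
  obtain ⟨v, hv⟩ := mem_stab_v.1 (hk .v)
  obtain ⟨w, hw⟩ := mem_stab_w.1 (hk .w)
  obtain ⟨k, hk⟩ := inU_eq_inW (hu.trans hw.symm)
  rcases inU_eq_inV (hu.trans hv.symm) with h1 | h1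
  · rw [h1, map_one] at hu
    exact inv_mul_eq_one.1 hu.symm
  · rw [h1] at hk
    exact (LetterSystem.letter_ne_one (S := pauliSystem) .X (congrArg SemidirectProduct.left hk)).elim

theorem tri_injective {v : ℤ × ℤ} {i i' : Fin 6} {b b' : Bool} (h : tri v i b = tri v i' b') :
    i = i' ∧ b = b' := by
  have hv : (tri v i b).1 = (tri v i' b').1 := congrArg Subtype.val h
  have h1 : fb v i ∈ (tri v i' b').1 := hv ▸ fb_mem_tri v i b
  rw [tri_val, Finset.mem_insert, Finset.mem_insert, Finset.mem_singleton] at h1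
  obtain rfl : i = i' := fb_injective v
    ((h1.resolve_left (vb_ne_fb _ _ _).symm).resolve_left (eb_ne_fb _ _ _ _).symm)
  refine ⟨rfl, ?_⟩
  have h2 : eb v (flagEdge i b) ∈ (tri v i b').1 := hv ▸ eb_mem_tri v i b
  rw [tri_val, Finset.mem_insert, Finset.mem_insert, Finset.mem_singleton] at h2
  have h3 := eb_injective v
    ((h2.resolve_left (vb_ne_eb _ _ _).symm).resolve_right (eb_ne_fb _ _ _ _))
  exact (by decide : ∀ i b b', flagEdge i b = flagEdge i b' → b = b') i b b' h3

/-- Two elements of the image of `W` outside of `U` are in the same coset of `U`. -/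
theorem inv_mul_mem_stab_u {y z : G} (hy : y ∈ stab .w) (hy' : y ∉ stab .u) (hz : z ∈ stab .w)
    (hz' : z ∉ stab .u) : y⁻¹ * z ∈ stab .u := by
  have key : ∀ {y : G}, y ∈ stab .w → y ∉ stab .u → cG * y ∈ stab .u := by
    intro y hy hy'
    obtain ⟨w, rfl⟩ := mem_stab_w.1 hy
    obtain ⟨k, hk | hk⟩ := inW_cases w
    · exact (hy' (mem_stab_u.2 ⟨_, hk.symm⟩)).elim
    · refine mem_stab_u.2 ⟨SemidirectProduct.inr k, ?_⟩
      rw [hk, rotG_mul_cG, ← mul_assoc, cG_mul_cG, one_mul]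
  have := mul_mem (inv_mem (key hy hy')) (key hz hz')
  rwa [mul_inv_rev, mul_assoc, inv_mul_cancel_left] at this

/-! ### Vertex types and transitions between neighbouring flags -/

namespace SimplicialEmbedding

variable (f : SimplicialEmbedding (sd E) Δ)

/-- The element of `G` that takes the fundamental triangle to the image of a flag. -/
noncomputable def elt (v : ℤ × ℤ) (i : Fin 6) (b : Bool) : G :=
  (exists_chamberΔ_eq (f.mapTriangle (tri v i b))).choose

theorem chamberΔ_elt (v : ℤ × ℤ) (i : Fin 6) (b : Bool) :
    chamberΔ (f.elt v i b) = f.mapTriangle (tri v i b) :=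
  (exists_chamberΔ_eq (f.mapTriangle (tri v i b))).choose_spec

theorem mem_chamber {v : ℤ × ℤ} {i : Fin 6} {b : Bool} {s : ESimplex} (hs : s ∈ (tri v i b).1) :
    ∃ k, f.toEmbedding s = vertexMk k (f.elt v i b) := by
  rw [← mem_chamber_iff]
  have h : chamber (f.elt v i b) = (tri v i b).1.map f.toEmbedding :=
    congrArg Subtype.val (f.chamberΔ_elt v i b)
  rw [h]
  exact Finset.mem_map_of_mem _ hs

theorem elt_injective {v : ℤ × ℤ} {i i' : Fin 6} {b b' : Bool}
    (h : f.elt v i b = f.elt v i' b') : i = i' ∧ b = b' := by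
  apply tri_injective (v := v)
  have h1 : f.mapTriangle (tri v i b) = f.mapTriangle (tri v i' b') := by
    rw [← chamberΔ_elt, h, chamberΔ_elt]
  exact Subtype.ext (Finset.map_injective f.toEmbedding (congrArg Subtype.val h1))

/-- The vertices of the plane go to cosets of `U`, since other vertices lie on fewer triangles. -/
theorem apply_vb (v : ℤ × ℤ) (i : Fin 6) (b : Bool) :
    f.toEmbedding (vb v) = vertexMk .u (f.elt v i b) := by
  obtain ⟨k, hk⟩ := f.mem_chamber (vb_mem_tri v i b)
  have hmem : ∀ q : Fin 6 × Bool, (f.elt v i b)⁻¹ * f.elt v q.1 q.2 ∈ stab k := by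
    intro q
    obtain ⟨k', hk'⟩ := f.mem_chamber (vb_mem_tri v q.1 q.2)
    exact (vertexMk_eq_iff.1 (hk.symm.trans hk')).2
  -- The twelve flags at `v` give twelve different elements of the local group, too many for `V` and
  -- `W`.
  have hcard : ∀ {Y : Type} [Group Y] [Fintype Y] (φ : Y →* G), Fintype.card Y < 12 →
      ¬ ∀ q : Fin 6 × Bool, ∃ y, φ y = (f.elt v i b)⁻¹ * f.elt v q.1 q.2 := by
    intro Y _ _ φ hY h
    choose y hy using h
    have hinj : Function.Injective y := by
      intro q q' hq
      have h1 := (hy q).symm.trans ((congrArg φ hq).trans (hy q'))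
      obtain ⟨h2, h3⟩ := f.elt_injective (mul_left_cancel h1)
      exact Prod.ext h2 h3
    have := Fintype.card_le_of_injective y hinj
    rw [Fintype.card_prod, Fintype.card_fin, Fintype.card_bool] at this
    omega
  cases k with
  | u => exact hk
  | v => exact (hcard inV (by decide) fun q => mem_stab_v.1 (hmem q)).elim
  | w => exact (hcard inW (by decide) fun q => mem_stab_w.1 (hmem q)).elim

theorem vb_ne {v w : ℤ × ℤ} {i j : Fin 6} {b c : Bool} (hvw : v ≠ w) :
    (f.elt v i b)⁻¹ * f.elt w j c ∉ stab .u := by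
  intro h
  have h1 := vertexMk_eq_iff.2 ⟨rfl, h⟩
  rw [← apply_vb, ← apply_vb] at h1
  exact hvw (vb_injective (f.toEmbedding.injective h1))

/-- The barycentres of faces go to cosets of `V`. -/
theorem apply_fb (v : ℤ × ℤ) (i : Fin 6) (b : Bool) :
    f.toEmbedding (fb v i) = vertexMk .v (f.elt v i b) := by
  obtain ⟨k, hk⟩ := f.mem_chamber (fb_mem_tri v i b)
  cases k with
  | v => exact hk
  | u =>
    rw [← f.apply_vb v i b] at hk
    exact (vb_ne_fb _ _ _ (f.toEmbedding.injective hk).symm).elim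
  | w =>
    exfalso
    have hw : ∀ w j, fb w j = fb v i → (f.elt v i b)⁻¹ * f.elt w j false ∈ stab .w := by
      intro w j h
      obtain ⟨k', hk'⟩ := f.mem_chamber (fb_mem_tri w j false)
      rw [h, hk] at hk'
      exact (vertexMk_eq_iff.1 hk').2
    -- `W` has two cosets modulo `W ∩ U`, while the three corners of a face would have to lie in
    -- three different ones.
    have h1 := inv_mul_mem_stab_u (hw _ _ (fb_add_dir v i)) (f.vb_ne (ne_add_dir v i))
      (hw _ _ (fb_add_dir_succ v i)) (f.vb_ne (ne_add_dir v (i + 1)))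
    rw [mul_inv_rev, inv_inv, mul_assoc, mul_inv_cancel_left] at h1
    exact f.vb_ne (fun h => fin_six_ne_add_one i (add_dir_inj h)) h1

/-- The midpoints of edges go to cosets of `W`. -/
theorem apply_eb (v : ℤ × ℤ) (i : Fin 6) (b : Bool) :
    f.toEmbedding (eb v (flagEdge i b)) = vertexMk .w (f.elt v i b) := by
  obtain ⟨k, hk⟩ := f.mem_chamber (eb_mem_tri v i b)
  cases k with
  | w => exact hk
  | u =>
    rw [← f.apply_vb v i b] at hk
    exact (vb_ne_eb _ _ _ (f.toEmbedding.injective hk).symm).elim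
  | v =>
    rw [← f.apply_fb v i b] at hk
    exact (eb_ne_fb _ _ _ _ (f.toEmbedding.injective hk)).elim

/-- These flags share a vertex and a face, so they differ by a nontrivial element of `U ∩ V`. -/
theorem elt_true (v : ℤ × ℤ) (i : Fin 6) : f.elt v i true = f.elt v i false * Pauli.X.toG := by
  have hu := (vertexMk_eq_iff.1 ((f.apply_vb v i false).symm.trans (f.apply_vb v i true))).2
  have hv := (vertexMk_eq_iff.1 ((f.apply_fb v i false).symm.trans (f.apply_fb v i true))).2
  obtain ⟨u, hu⟩ := mem_stab_u.1 hu
  obtain ⟨y, hy⟩ := mem_stab_v.1 hv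
  rw [← inv_mul_eq_iff_eq_mul, ← hu]
  rcases inU_eq_inV (hu.trans hy.symm) with rfl | rfl
  · rw [map_one, eq_comm, inv_mul_eq_one] at hu
    cases (f.elt_injective hu).2
  · rfl

/-- These flags share an edge and a face, so they differ by a nontrivial element of `V ∩ W`. -/
theorem elt_add_dir (v : ℤ × ℤ) (i : Fin 6) :
    f.elt (v + dir i) (i + 2) true = f.elt v i false * cG := by
  have h1 := f.apply_fb (v + dir i) (i + 2) true
  have h2 := f.apply_eb (v + dir i) (i + 2) true
  rw [fb_add_dir, f.apply_fb v i false] at h1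
  have h3 : eb (v + dir i) (flagEdge (i + 2) true) = eb v (flagEdge i false) := by
    rw [flagEdge, if_pos rfl, show i + 2 + 1 = i + 3 from add_assoc i 2 1, eb_add_dir]
    rfl
  rw [h3, f.apply_eb v i false] at h2
  obtain ⟨y, hy⟩ := mem_stab_v.1 (vertexMk_eq_iff.1 h1).2
  obtain ⟨w, hw⟩ := mem_stab_w.1 (vertexMk_eq_iff.1 h2).2
  rw [← inv_mul_eq_iff_eq_mul, ← hy]
  rcases inV_eq_inW (hy.trans hw.symm) with h | h
  · exfalso
    apply f.vb_ne (i := i) (j := i + 2) (b := false) (c := true) (ne_add_dir v i)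
    rw [← hy, h]
    exact one_mem _
  · exact h

/-- These flags share a vertex and an edge, so they differ by a nontrivial element of `U ∩ W`. -/
theorem elt_succ (v : ℤ × ℤ) (i : Fin 6) : ∃ k, k ≠ 1 ∧
    f.elt v (i + 1) false = f.elt v i true * inU (SemidirectProduct.inr k) := by
  have h1 := (f.apply_vb v i true).symm.trans (f.apply_vb v (i + 1) false)
  have h2 := (f.apply_eb v i true).symm.trans (f.apply_eb v (i + 1) false)
  obtain ⟨u, hu⟩ := mem_stab_u.1 (vertexMk_eq_iff.1 h1).2
  obtain ⟨w, hw⟩ := mem_stab_w.1 (vertexMk_eq_iff.1 h2).2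
  obtain ⟨k, rfl⟩ := inU_eq_inW (hu.trans hw.symm)
  refine ⟨k, ?_, by rw [← inv_mul_eq_iff_eq_mul, hu]⟩
  rintro rfl
  rw [map_one, map_one, eq_comm, inv_mul_eq_one] at hu
  exact fin_six_ne_add_one i (f.elt_injective hu).1

/-- The mark of the image of a face. -/
noncomputable def faceMark (v : ℤ × ℤ) (i : Fin 6) : Pauli :=
  Pauli.next^[(Multiplicative.toAdd (tau (f.elt v i false))).val] Pauli.X

theorem tau_elt_true (v : ℤ × ℤ) (i : Fin 6) : tau (f.elt v i true) = tau (f.elt v i false) := by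
  rw [elt_true, map_mul, tau_toG, mul_one]

theorem mark_mapTriangle (v : ℤ × ℤ) (i : Fin 6) (b : Bool) :
    mark (f.mapTriangle (tri v i b)) = f.faceMark v i := by
  rw [← chamberΔ_elt, mark_chamberΔ, faceMark]
  cases b
  · rfl
  · rw [tau_elt_true]

theorem shift_faceMark (v : ℤ × ℤ) (i : Fin 6) : (f.faceMark v i).shift = tau (f.elt v i false) :=
  Pauli.shift_next_iterate _

theorem faceMark_add_dir (v : ℤ × ℤ) (i : Fin 6) :
    f.faceMark (v + dir i) (i + 2) = f.faceMark v i := by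
  rw [faceMark, ← tau_elt_true, elt_add_dir, map_mul, tau_cG, mul_one, faceMark]

theorem faceMark_eq_of_fb_eq {v w : ℤ × ℤ} {i j : Fin 6} (h : fb w j = fb v i) :
    f.faceMark w j = f.faceMark v i := by
  rcases eq_of_fb_eq h with ⟨rfl, rfl⟩ | ⟨rfl, rfl⟩ | ⟨rfl, rfl⟩
  · rfl
  · exact f.faceMark_add_dir v i
  · have := f.faceMark_add_dir (v + dir i) (i + 2)
    rwa [add_assoc v, dir_add_two, add_assoc i, faceMark_add_dir] at this

theorem faceMark_ne (v : ℤ × ℤ) (i : Fin 6) : f.faceMark v i ≠ f.faceMark v (i + 1) := by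
  intro h
  obtain ⟨k, hk, he⟩ := f.elt_succ v i
  have h1 := congrArg Pauli.shift h
  rw [shift_faceMark, shift_faceMark, he, map_mul, tau_elt_true, tau_inU] at h1
  exact hk (left_eq_mul.1 h1)

/-- The oriented edge of a flag. -/
noncomputable def edgeElt (v : ℤ × ℤ) (i : Fin 6) : G :=
  f.elt v i false * (f.faceMark v i).rotG⁻¹

/-- The correction by `rotG` absorbs the power of `T` between the two faces, leaving only the
conjugate of `X` by the rotation of the first face. -/
theorem edgeElt_succ (v : ℤ × ℤ) (i : Fin 6) :
    f.edgeElt v (i + 1) = f.edgeElt v i * (f.faceMark v i).swapYZ.toG := by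
  obtain ⟨k, -, he⟩ := f.elt_succ v i
  have h1 : (f.faceMark v (i + 1)).rotG =
      (f.faceMark v i).rotG * inU (SemidirectProduct.inr k) := by
    rw [Pauli.rotG, shift_faceMark, he, map_mul, tau_elt_true, tau_inU, Pauli.rotG,
      shift_faceMark, ← map_mul, ← map_mul]
    rfl
  have h2 : (f.faceMark v i).swapYZ.toG =
      (f.faceMark v i).rotG * Pauli.X.toG * (f.faceMark v i).rotG⁻¹ := by
    rw [rotG_mul_X, mul_inv_cancel_right]
  rw [edgeElt, edgeElt, h1, he, h2, elt_true]
  group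

/-- The marking of the faces of the plane defined by an embedding. -/
noncomputable def tile (F : Triangle E) : Pauli :=
  f.faceMark F.2.1.1.choose (exists_around_eq F F.2.1.1.choose_spec).choose

theorem tile_around (v : ℤ × ℤ) (i : Fin 6) : f.tile (around v i) = f.faceMark v i := by
  apply f.faceMark_eq_of_fb_eq
  have h := (exists_around_eq (around v i) (around v i).2.1.1.choose_spec).choose_spec
  exact Subtype.ext (congrArg Subtype.val h).symm

/-- The Pauli puzzle defined by an embedding. -/
noncomputable def puzzle : Puzzle where
  tile := f.tile
  adjacent F F' h := by
    obtain ⟨v, i, ⟨rfl, rfl⟩ | ⟨rfl, rfl⟩⟩ := exists_consecutive h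
    · rw [tile_around, tile_around]
      exact f.faceMark_ne v i
    · rw [tile_around, tile_around]
      exact (f.faceMark_ne v i).symm
  ring v := by
    rw [ring_iff fun i => f.tile (around v i)]
    simp only [tile_around]
    -- Six turns return to the initial edge, so their product is 1.
    have h0 : f.edgeElt v 1 = f.edgeElt v 0 * _ := f.edgeElt_succ v 0
    have h1 : f.edgeElt v 2 = f.edgeElt v 1 * _ := f.edgeElt_succ v 1
    have h2 : f.edgeElt v 3 = f.edgeElt v 2 * _ := f.edgeElt_succ v 2
    have h3 : f.edgeElt v 4 = f.edgeElt v 3 * _ := f.edgeElt_succ v 3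
    have h4 : f.edgeElt v 5 = f.edgeElt v 4 * _ := f.edgeElt_succ v 4
    have h5 : f.edgeElt v 0 = f.edgeElt v 5 * _ := f.edgeElt_succ v 5
    rw [h4, h3, h2, h1, h0] at h5
    simp only [mul_assoc] at h5 ⊢
    exact left_eq_mul.1 h5

theorem preservesMarks_puzzle : PreservesMarks f.puzzle f := by
  intro s F hF
  obtain ⟨v, i, b, rfl⟩ := exists_tri_eq s
  obtain rfl := liesIn_tri_iff.1 hF
  rw [mark_mapTriangle]
  exact (f.tile_around v i).symm

end SimplicialEmbedding

/-! ### Uniqueness on both sides -/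

theorem eq_of_preservesMarks {p p' : Puzzle} {f : SimplicialEmbedding (sd E) Δ}
    (h : PreservesMarks p f) (h' : PreservesMarks p' f) : p = p' := by
  apply Puzzle.ext
  funext F
  obtain ⟨x, hx⟩ := F.2.1.1
  obtain ⟨i, rfl⟩ := exists_around_eq F hx
  have hl := liesIn_tri_iff (b := false).2 (rfl : around x i = around x i)
  rw [← h _ _ hl, h' _ _ hl]

theorem PreservesMarks.tau_elt {p : Puzzle} {f : SimplicialEmbedding (sd E) Δ}
    (h : PreservesMarks p f) (v : ℤ × ℤ) (i : Fin 6) :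
    tau (f.elt v i false) = (p.tile (around v i)).shift := by
  rw [← h (tri v i false) _ (liesIn_tri_iff.2 rfl), f.mark_mapTriangle, f.shift_faceMark]

/-- The power of `T` between consecutive faces is the only freedom of an embedding, and `τ` reads it
off from the two marks. -/
theorem PreservesMarks.elt_succ {p : Puzzle} {f : SimplicialEmbedding (sd E) Δ}
    (h : PreservesMarks p f) (v : ℤ × ℤ) (i : Fin 6) :
    f.elt v (i + 1) false = f.elt v i false * Pauli.X.toG * inU (SemidirectProduct.inr
      ((p.tile (around v i)).shift⁻¹ * (p.tile (around v (i + 1))).shift)) := by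
  obtain ⟨k, -, hk⟩ := f.elt_succ v i
  have h1 := congrArg tau hk
  rw [map_mul, f.tau_elt_true, tau_inU, h.tau_elt, h.tau_elt] at h1
  rw [hk, f.elt_true, h1, inv_mul_cancel_left]
  rfl

/-- A pointed embedding is determined by the marks. -/
theorem embedding_unique {p : Puzzle} {f f' : SimplicialEmbedding (sd E) Δ}
    (h : PreservesMarks p f) (h' : PreservesMarks p f') {t : Triangle (sd E)}
    (ht : f.mapTriangle t = f'.mapTriangle t) : f = f' := by
  have hround : ∀ v i, f.elt v i false = f'.elt v i false →
      ∀ j, f.elt v j false = f'.elt v j false := by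
    intro v i hi
    have hstep : ∀ j, f.elt v j false = f'.elt v j false →
        f.elt v (j + 1) false = f'.elt v (j + 1) false := by
      intro j hj
      rw [h.elt_succ, h'.elt_succ, hj]
    intro j
    have hj : ∀ i j : Fin 6, j = i ∨ j = i + 1 ∨ j = i + 1 + 1 ∨ j = i + 1 + 1 + 1 ∨
        j = i + 1 + 1 + 1 + 1 ∨ j = i + 1 + 1 + 1 + 1 + 1 := by decide
    have h1 := hstep _ hi
    have h2 := hstep _ h1
    have h3 := hstep _ h2
    have h4 := hstep _ h3
    have h5 := hstep _ h4
    rcases hj i j with rfl | rfl | rfl | rfl | rfl | rfl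
    exacts [hi, h1, h2, h3, h4, h5]
  have htrue : ∀ v i, f.elt v i true = f'.elt v i true → f.elt v i false = f'.elt v i false := by
    intro v i hi
    rw [f.elt_true, f'.elt_true] at hi
    exact mul_right_cancel hi
  obtain ⟨v, i, b, rfl⟩ := exists_tri_eq t
  have h0 : f.elt v i b = f'.elt v i b := by
    rw [← f.chamberΔ_elt, ← f'.chamberΔ_elt] at ht
    exact chamber_injective (congrArg Subtype.val ht)
  have hall : ∀ w j, f.elt w j false = f'.elt w j false := by
    refine plane_induction (Q := fun w => ∀ j, f.elt w j false = f'.elt w j false) v ?_ ?_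
    · apply hround v i
      cases b
      · exact h0
      · exact htrue v i h0
    · intro w k hw
      apply hround (w + dir k) (k + 2)
      apply htrue
      rw [f.elt_add_dir, f'.elt_add_dir, hw]
  apply SimplicialEmbedding.ext
  apply Function.Embedding.ext
  intro s
  obtain ⟨x, hx⟩ := s.2.1
  rcases simplex_cases s hx with rfl | ⟨j, rfl⟩ | ⟨j, rfl⟩
  · rw [f.apply_vb x 0 false, f'.apply_vb x 0 false, hall]
  · have h1 := f.apply_eb x j false
    have h2 := f'.apply_eb x j false
    rw [hall, ← h2] at h1
    exact h1
  · rw [f.apply_fb x j false, f'.apply_fb x j false, hall]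

theorem exists_equiv_of_existsUnique {α β : Type} (R : α → β → Prop) (h : ∀ a, ∃! b, R a b)
    (h' : ∀ b, ∃! a, R a b) : ∃ Φ : α ≃ β, ∀ a b, Φ a = b ↔ R a b := by
  choose φ hφ hφ' using h
  choose ψ hψ hψ' using h'
  refine ⟨⟨φ, ψ, fun a => (hψ' _ _ (hφ a)).symm, fun b => (hφ' _ _ (hψ b)).symm⟩, fun a b => ?_⟩
  constructor
  · rintro rfl; exact hφ a
  · intro hab; exact (hφ' _ _ hab).symm

end PauliPuzzle

/-! ### The bijection -/

theorem mainTheorem2 (t : PauliPuzzle.Triangle (PauliPuzzle.sd PauliPuzzle.E)) :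
    ∃ Φ : PauliPuzzle.PointedPuzzle t ≃ PauliPuzzle.PointedEmbedding t,
      ∀ (p : PauliPuzzle.PointedPuzzle t) (f : PauliPuzzle.PointedEmbedding t),
        Φ p = f ↔ PauliPuzzle.PreservesMarks p.1 f.1 := by
  apply PauliPuzzle.exists_equiv_of_existsUnique
    (fun (p : PauliPuzzle.PointedPuzzle t) (f : PauliPuzzle.PointedEmbedding t) =>
      PauliPuzzle.PreservesMarks p.1 f.1)
  · intro p
    obtain ⟨f, hf⟩ := PauliPuzzle.exists_embedding t p
    exact ⟨f, hf, fun f' hf' =>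
      Subtype.ext (PauliPuzzle.embedding_unique hf' hf (f'.2.trans f.2.symm))⟩
  · intro f
    refine ⟨⟨f.1.puzzle, fun F hF => ?_⟩, f.1.preservesMarks_puzzle, fun p hp =>
      Subtype.ext (PauliPuzzle.eq_of_preservesMarks hp f.1.preservesMarks_puzzle)⟩
    -- The puzzle is pointed at `t` because `t` goes to `t₀`, whose mark is `X`.
    rw [← f.1.preservesMarks_puzzle t F hF, f.2, PauliPuzzle.t₀, PauliPuzzle.mark_chamberΔ,
      map_one]
    rfl
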